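/- **Ground-state covariance clustering.** Let $d\in\mathbb N$, $\alpha>d$ and $J>0$. Let $\Lambda\subset\mathbb Z^d$ be any finite set of sites, $|r-r'|$ the Euclidean distance, and $I$ any finite set of internal states. A matrix $M$ indexed by $\Lambda\times K$ ($K$ a finite set) has blocks $M_{rr'}=(M_{rs,r's'})_{s,s'\in K}$, and $\|\cdot\|$ is the operator norm; $M$ is called *$\alpha$-decaying with amplitude $J$* if $\|M_{rr'}\|\le J/(|r-r'|+1)^\alpha$ for all $r,r'\in\Lambda$. For a Hermitian matrix, *gapped with gap parameter $\Delta>0$* means that every eigenvalue $\lambda$ satisfies $|\lambda|\ge\Delta$ (the Fermi level, placed at $0$, lies in the gap). Let $\hat c_{rs}$ be the fermionic annihilation operators on the Fock space over $\Lambda\times I$. (i) *Number conserving case.* There are a real polynomial $Q$ of degree at most $\frac{\alpha(\alpha+1)}{\alpha-d}+1$ and constants $a,b\in\mathbb R$, all depending only on $d,\alpha,J$, such that the following holds with $$P_\Delta(t)=Q(t)+\frac a\Delta+\frac b{\sqrt\Delta}.$$ For every $\Delta>0$, all finite $\Lambda\subset\mathbb Z^d$ and $I$, every Hermitian matrix $H$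 on $\Lambda\times I$ that is $\alpha$-decaying with amplitude $J$ and gapped with parameter $\Delta$, and every normalized ground state $\Psi$ of $\hat H=\sum H_{rs,r's'}\hat c^\dagger_{rs}\hat c_{r's'}$, the covariance matrix $C_{rs,r's'}=\langle\Psi|\hat c^\dagger_{r's'}\hat c_{rs}|\Psi\rangle$ equals $\frac12(\mathbb 1-\operatorname{sgn}H)$ and satisfies, for all $r,r'\in\Lambda$, $$\|C_{rr'}\|\le\frac{P_\Delta\!\left(\frac{2\alpha}{\Delta}\log(|r-r'|+1)\right)}{(|r-r'|+1)^\alpha}.$$ In particular, for every $\Delta>0$ and $\varepsilon>0$ there is a constant $K_\varepsilon$, depending only on $d,\alpha,J,\Delta,\varepsilon$, such that $\|C_{rr'}\|\le K_\varepsilon/(|r-r'|+1)^{\alpha-\varepsilon}$ for all such $\Lambda,I,H,\Psi,r,r'$. (ii) *Case without number conservation.* Let $\hat\gamma_{rs+}=\hat c^\dagger_{rs}+\hat c_{rs}$ and $\hat\gamma_{rs-}=i(\hat c^\dagger_{rs}-\hat c_{rs})$, and write $S=(s,\pm)$. The same holds (with possibly different $Q,a,b,K_\varepsilon$ of the same kind,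 and the same bound on $\deg Q$) for every real antisymmetric matrix $A$ on $\Lambda\times(I\times\{\pm\})$ that is $\alpha$-decaying with amplitude $J$ and for which $iA$ is gapped with parameter $\Delta$: for every normalized ground state $\Psi$ of $\hat H=\frac i2\sum A_{rS,r'S'}\hat\gamma_{rS}\hat\gamma_{r'S'}$, the Majorana covariance matrix $\Gamma_{rS,r'S'}=\frac i2\langle\Psi|[\hat\gamma_{rS},\hat\gamma_{r'S'}]|\Psi\rangle$ equals $i\operatorname{sgn}(iA)$, and $\|\Gamma_{rr'}\|$ satisfies both bounds. -/

import Mathlib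

open scoped Polynomial

noncomputable section

namespace FreeFermion

/-! ### Lattice geometry, blocks, operator norm, decay, gap -/

/-- The Euclidean distance `|r - r'|` between two points of the hypercubic lattice `ℤ^d`. -/
def latticeDist {d : ℕ} (r r' : Fin d → ℤ) : ℝ :=
  Real.sqrt (∑ i, ((r i : ℝ) - (r' i : ℝ)) ^ 2)

/-- The operator norm of a square matrix with respect to the Euclidean (`ℓ²`) norm. -/
def opNorm {𝕜 : Type*} [RCLike 𝕜] {n : Type*} [Fintype n] [DecidableEq n]
    (M : Matrix n n 𝕜) : ℝ :=
  ‖Matrix.toEuclideanCLM (n := n) (𝕜 := 𝕜) M‖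

/-- The block `M_{r r'}` (acting on internal states) of a matrix indexed by pairs
(site, internal state). -/
def siteBlock {𝕜 S K : Type*} (M : Matrix (S × K) (S × K) 𝕜) (r r' : S) : Matrix K K 𝕜 :=
  Matrix.of fun s s' => M (r, s) (r', s')

/-- `α`-decay with amplitude `J`: `‖M_{r r'}‖ ≤ J / (|r - r'| + 1) ^ α` for all sites. -/
def IsDecaying {𝕜 : Type*} [RCLike 𝕜] {d : ℕ} {Λ : Finset (Fin d → ℤ)}
    {K : Type*} [Fintype K] [DecidableEq K] (α J : ℝ) (M : Matrix (Λ × K) (Λ × K) 𝕜) : Prop :=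
  ∀ r r' : Λ, opNorm (siteBlock M r r') ≤ J / (latticeDist r.1 r'.1 + 1) ^ α

/-- The matrix `M` (Hermitian in all uses) has no eigenvalue in `(-Δ, Δ)`. -/
def IsGapped {n : Type*} [Fintype n] [DecidableEq n] (Δ : ℝ) (M : Matrix n n ℂ) : Prop :=
  ∀ x ∈ spectrum ℝ M, Δ ≤ |x|

/-- The matrix sign function of a Hermitian matrix. -/
def matrixSgn {n : Type*} [Fintype n] [DecidableEq n] (M : Matrix n n ℂ) : Matrix n n ℂ :=
  cfc Real.sign M

/-! ### Fermionic Fock space over a finite set of modes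

The occupation-number basis of the Fock space is indexed by the finsets of occupied modes. Signs
are fixed by an (arbitrary) enumeration of the modes. -/

section Fock

variable {ι : Type*} [Fintype ι] [DecidableEq ι]

/-- The number of modes occupied in `T` that precede the mode `i`. -/
def occupiedBefore (i : ι) (T : Finset ι) : ℕ :=
  (T.filter fun j => Fintype.equivFin ι j < Fintype.equivFin ι i).card

/-- The annihilation operator `ĉ_i`: it sends the basis state `T` to `0` if `i ∉ T`, and to
`(-1)^(number of occupied modes before i)` times the basis state `T \ {i}` if `i ∈ T`. -/
def annihilation (i : ι) : Matrix (Finset ι) (Finset ι) ℂ :=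
  Matrix.of fun S T => if i ∈ T ∧ S = T.erase i then (-1) ^ occupiedBefore i T else 0

/-- The creation operator `ĉ_i†`. -/
def creation (i : ι) : Matrix (Finset ι) (Finset ι) ℂ :=
  (annihilation i).conjTranspose

/-- The expectation value `⟨Ψ| O |Ψ⟩`. -/
def expectation (O : Matrix (Finset ι) (Finset ι) ℂ) (Ψ : Finset ι → ℂ) : ℂ :=
  star Ψ ⬝ᵥ O.mulVec Ψ

/-- `Ψ` is a normalized ground state of the many-body Hamiltonian `Hhat`: a unit eigenvector for
the smallest eigenvalue. -/
def IsGroundState (Hhat : Matrix (Finset ι) (Finset ι) ℂ) (Ψ : Finset ι → ℂ) : Prop :=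
  star Ψ ⬝ᵥ Ψ = 1 ∧
    ∃ E : ℝ, Hhat.mulVec Ψ = (E : ℂ) • Ψ ∧ ∀ E' ∈ spectrum ℝ Hhat, E ≤ E'

/-- The number-conserving quadratic Hamiltonian `∑_{p,q} H_{pq} ĉ_p† ĉ_q`. -/
def numberHamiltonian (H : Matrix ι ι ℂ) : Matrix (Finset ι) (Finset ι) ℂ :=
  ∑ p, ∑ q, H p q • (creation p * annihilation q)

/-- The covariance matrix `C_{pq} = ⟨Ψ| ĉ_q† ĉ_p |Ψ⟩`. -/
def covariance (Ψ : Finset ι → ℂ) : Matrix ι ι ℂ :=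
  Matrix.of fun p q => expectation (creation q * annihilation p) Ψ

end Fock

/-! ### Majorana formalism

Sites form a type `S` and internal states a type `I`; the modes are `S × I`, and the Majorana
operators are indexed by `S × (I × Bool)`, where `true` stands for `+` and `false` for `-`. -/

section Majorana

variable {S I : Type*} [Fintype S] [DecidableEq S] [Fintype I] [DecidableEq I]

/-- `γ̂_{rs+} = ĉ_{rs}† + ĉ_{rs}` and `γ̂_{rs-} = i (ĉ_{rs}† - ĉ_{rs})`. -/
def majorana (x : S × (I × Bool)) : Matrix (Finset (S × I)) (Finset (S × I)) ℂ :=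
  if x.2.2 then creation (x.1, x.2.1) + annihilation (x.1, x.2.1)
  else Complex.I • (creation (x.1, x.2.1) - annihilation (x.1, x.2.1))

/-- The general quadratic Hamiltonian `(i/2) ∑_{x,y} A_{xy} γ̂_x γ̂_y`. -/
def majoranaHamiltonian (A : Matrix (S × (I × Bool)) (S × (I × Bool)) ℝ) :
    Matrix (Finset (S × I)) (Finset (S × I)) ℂ :=
  (Complex.I / 2) • ∑ x, ∑ y, (A x y : ℂ) • (majorana x * majorana y)

/-- The Majorana covariance matrix `Γ_{xy} = (i/2) ⟨Ψ| [γ̂_x, γ̂_y] |Ψ⟩`. -/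
def majoranaCovariance (Ψ : Finset (S × I) → ℂ) :
    Matrix (S × (I × Bool)) (S × (I × Bool)) ℂ :=
  Matrix.of fun x y =>
    (Complex.I / 2) * expectation (majorana x * majorana y - majorana y * majorana x) Ψ

/-- The complex matrix `i A` of a real matrix `A` (Hermitian when `A` is antisymmetric). -/
def iTimes {n : Type*} (A : Matrix n n ℝ) : Matrix n n ℂ :=
  Complex.I • A.map (fun x : ℝ => (x : ℂ))

end Majorana

/-! ### The clustering bound -/

/-- `P_Δ((2α/Δ) log(ρ + 1)) / (ρ + 1) ^ α`, where `P_Δ(t) = Q(t) + a / Δ + b / √Δ`. -/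
def clusteringBound (α Δ : ℝ) (Q : ℝ[X]) (a b ρ : ℝ) : ℝ :=
  (Q.eval (2 * α / Δ * Real.log (ρ + 1)) + a / Δ + b / Real.sqrt Δ) / (ρ + 1) ^ α

end FreeFermion

end

/-!
The many-body part is algebra. Both Hamiltonians are quadratic, so the commutator with a creation
operator (or a Majorana operator) attached to an eigenvector `v` of the one-particle matrix is a
multiple of the same operator, with the eigenvalue as the energy difference. An operator that lowers
the energy annihilates a ground state (`IsGroundState.mulVec_eq_zero`). Together with the canonical
anticommutation relations this determines how the covariance matrix acts on every eigenvector, and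
identifies it as a function of the sign of the one-particle matrix (`covariance_eq`,
`majoranaCovariance_eq`).

It remains to bound the blocks of `sgn H`. As
`sgn H = π⁻¹ ∫ (H - iy)⁻¹ H (H + iy)⁻¹ dy`, and as matrices with `α`-decaying blocks form an algebra
for `α > d` (`BlockDecay.mul`), it suffices to control the decay of the resolvents
(`exists_resolvent_blockDecay`). For this, `H` is split into a part of finite range `χ` and a
long-range part. The resolvent of the former decays exponentially on the scale `L ~ χ / Δ` by a
Combes–Thomas argument (`norm_block_inverse_le_exp`). After grouping the sites into cubes of side
`L`, the long-range part has norm of order `χ ^ (-β)` in the algebra of `α`-decaying matrices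
(`BlockDecay.coarse`), for any `β < α - d`. For `χ` of order `Δ ^ (-1 / β)` it is a small
perturbation, and the full resolvent inherits the decay on the scale `L`.

In total, the blocks of `sgn H` are bounded by `c Δ ^ (-N) / (|r - r'| + 1) ^ α` with
`N = ⌈α (α + 1) / (α - d)⌉` (`exists_matrixSgn_blockDecay`). This has no logarithms; since
`log (|r - r'| + 1) ≥ log 2` for distinct sites, it is dominated by the monomial of degree `N` in
`(2 α / Δ) log (|r - r'| + 1)`, so that `a = b = 0` is possible in the clustering bound.
-/

noncomputable section

namespace FreeFermion

open scoped Matrix.Norms.L2Operator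

/-! ### Blocks of a matrix and the Schur test -/

section Blocks

variable {n ι : Type*} [DecidableEq n] [DecidableEq ι]

/-- The orthogonal projection onto the coordinates `i` with label `pos i = X`. For a labelling of
the indices, `blockProj pos X * M * blockProj pos Y` is the `(X, Y)` block of `M`, extended by
zero to a matrix of the original size. -/
def blockProj (pos : n → ι) (X : ι) : Matrix n n ℂ :=
  Matrix.diagonal fun i => if pos i = X then 1 else 0

variable {pos : n → ι}

lemma sum_blockProj {T : Finset ι} (hT : ∀ i, pos i ∈ T) : ∑ X ∈ T, blockProj pos X = 1 := by
  ext i j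
  rw [Matrix.sum_apply]
  by_cases h : i = j
  · subst h
    simp [blockProj, hT i]
  · simp [blockProj, h]

variable [Fintype n]

lemma block_apply (M : Matrix n n ℂ) (X Y : ι) (i j : n) :
    (blockProj pos X * M * blockProj pos Y) i j =
      if pos i = X ∧ pos j = Y then M i j else 0 := by
  simp only [blockProj, Matrix.mul_diagonal, Matrix.diagonal_mul]
  by_cases h1 : pos i = X <;> by_cases h2 : pos j = Y <;> simp [h1, h2]

lemma blockProj_mul_self (X : ι) : blockProj pos X * blockProj pos X = blockProj pos X := by
  simp [blockProj, Matrix.diagonal_mul_diagonal]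

lemma norm_blockProj_le (X : ι) : ‖blockProj pos X‖ ≤ 1 := by
  rw [blockProj, Matrix.l2_opNorm_diagonal, pi_norm_le_iff_of_nonneg zero_le_one]
  intro i
  by_cases h : pos i = X <;> simp [h]

lemma norm_block_le (M : Matrix n n ℂ) (X Y : ι) :
    ‖blockProj pos X * M * blockProj pos Y‖ ≤ ‖M‖ := by
  calc _ ≤ ‖blockProj pos X‖ * ‖M‖ * ‖blockProj pos Y‖ :=
        (norm_mul_le _ _).trans (mul_le_mul_of_nonneg_right (norm_mul_le _ _) (norm_nonneg _))
    _ ≤ 1 * ‖M‖ * 1 := by gcongr <;> exact norm_blockProj_le _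
    _ = ‖M‖ := by ring

lemma block_eq_zero {M : Matrix n n ℂ} {X Y : ι}
    (h : (∀ i, pos i ≠ X) ∨ ∀ i, pos i ≠ Y) :
    blockProj pos X * M * blockProj pos Y = 0 := by
  ext i j
  rw [block_apply, Matrix.zero_apply, if_neg]
  rintro ⟨hi, hj⟩
  rcases h with h | h
  · exact h i hi
  · exact h j hj

lemma norm_block_mul_le {T : Finset ι} (hT : ∀ i, pos i ∈ T) (A B : Matrix n n ℂ) (X Y : ι) :
    ‖blockProj pos X * (A * B) * blockProj pos Y‖ ≤
      ∑ Z ∈ T, ‖blockProj pos X * A * blockProj pos Z‖ *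
        ‖blockProj pos Z * B * blockProj pos Y‖ := by
  have h : blockProj pos X * (A * B) * blockProj pos Y =
      ∑ Z ∈ T, (blockProj pos X * A * blockProj pos Z) *
        (blockProj pos Z * B * blockProj pos Y) := by
    have : ∀ Z, (blockProj pos X * A * blockProj pos Z) * (blockProj pos Z * B * blockProj pos Y) =
        (blockProj pos X * A) * blockProj pos Z * (B * blockProj pos Y) := fun Z => by
      rw [← blockProj_mul_self (pos := pos) Z]
      simp only [Matrix.mul_assoc]
      rw [← Matrix.mul_assoc (blockProj pos Z) (blockProj pos Z), blockProj_mul_self,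
        ← Matrix.mul_assoc (blockProj pos Z) (blockProj pos Z), blockProj_mul_self]
    simp_rw [this]
    rw [← Finset.sum_mul, ← Finset.mul_sum, sum_blockProj hT, Matrix.mul_one]
    simp only [Matrix.mul_assoc]
  rw [h]
  exact (norm_sum_le _ _).trans (Finset.sum_le_sum fun Z _ => norm_mul_le _ _)

lemma norm_sq_blockProj (X : ι) (x : EuclideanSpace ℂ n) :
    ‖Matrix.toEuclideanCLM (n := n) (𝕜 := ℂ) (blockProj pos X) x‖ ^ 2 =
      ∑ i, if pos i = X then ‖x i‖ ^ 2 else 0 := by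
  rw [EuclideanSpace.norm_sq_eq]
  refine Finset.sum_congr rfl fun i _ => ?_
  rw [Matrix.ofLp_toEuclideanCLM, blockProj, Matrix.mulVec_diagonal]
  by_cases h : pos i = X <;> simp [h]

lemma sum_norm_sq_blockProj {T : Finset ι} (hT : ∀ i, pos i ∈ T) (x : EuclideanSpace ℂ n) :
    ∑ X ∈ T, ‖Matrix.toEuclideanCLM (n := n) (𝕜 := ℂ) (blockProj pos X) x‖ ^ 2 = ‖x‖ ^ 2 := by
  simp_rw [norm_sq_blockProj]
  rw [Finset.sum_comm, EuclideanSpace.norm_sq_eq]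
  refine Finset.sum_congr rfl fun i _ => ?_
  simp [hT i]

/-- **Schur test** for block matrices: if all row and column sums of the norms of the blocks are at
most `R`, then so is the operator norm. -/
lemma norm_le_of_schur {T : Finset ι} (hT : ∀ i, pos i ∈ T) {M : Matrix n n ℂ} {R : ℝ}
    (hR : 0 ≤ R)
    (hrow : ∀ X ∈ T, ∑ Y ∈ T, ‖blockProj pos X * M * blockProj pos Y‖ ≤ R)
    (hcol : ∀ Y ∈ T, ∑ X ∈ T, ‖blockProj pos X * M * blockProj pos Y‖ ≤ R) : ‖M‖ ≤ R := by
  set b : ι → ι → ℝ := fun X Y => ‖blockProj pos X * M * blockProj pos Y‖ with hb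
  have hb0 : ∀ X Y, 0 ≤ b X Y := fun X Y => norm_nonneg _
  rw [Matrix.cstar_norm_def]
  refine ContinuousLinearMap.opNorm_le_bound _ hR fun x => ?_
  set E := Matrix.toEuclideanCLM (n := n) (𝕜 := ℂ) with hE
  set f : ι → ℝ := fun Y => ‖E (blockProj pos Y) x‖ with hf
  have hrowbd : ∀ X, ‖E (blockProj pos X) (E M x)‖ ≤ ∑ Y ∈ T, b X Y * f Y := by
    intro X
    have : E (blockProj pos X) (E M x) =
        ∑ Y ∈ T, E (blockProj pos X * M * blockProj pos Y) (E (blockProj pos Y) x) := by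
      have h1 : ∀ Y, E (blockProj pos X * M * blockProj pos Y) (E (blockProj pos Y) x) =
          E (blockProj pos X * M * blockProj pos Y) x := fun Y => by
        rw [← mul_apply_eq_comp, ← map_mul, Matrix.mul_assoc _ (blockProj pos Y),
          blockProj_mul_self]
      simp_rw [h1]
      rw [← sum_apply, ← map_sum, ← Finset.mul_sum, sum_blockProj hT,
        Matrix.mul_one, map_mul]
      rfl
    rw [this]
    refine (norm_sum_le _ _).trans (Finset.sum_le_sum fun Y _ => ?_)
    exact ContinuousLinearMap.le_opNorm _ _
  refine le_of_sq_le_sq ?_ (by positivity)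
  rw [← sum_norm_sq_blockProj hT (E M x), mul_pow, ← sum_norm_sq_blockProj hT x]
  calc ∑ X ∈ T, ‖E (blockProj pos X) (E M x)‖ ^ 2
      ≤ ∑ X ∈ T, (∑ Y ∈ T, b X Y * f Y) ^ 2 := by
        gcongr with X _
        exact hrowbd X
    _ ≤ ∑ X ∈ T, R * ∑ Y ∈ T, b X Y * f Y ^ 2 := by
        refine Finset.sum_le_sum fun X hX => ?_
        have hcs : (∑ Y ∈ T, b X Y * f Y) ^ 2 ≤ (∑ Y ∈ T, b X Y) * ∑ Y ∈ T, b X Y * f Y ^ 2 := by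
          refine Finset.sum_sq_le_sum_mul_sum_of_sq_le_mul _ (fun Y _ => hb0 X Y)
            (fun Y _ => mul_nonneg (hb0 X Y) (sq_nonneg _)) (fun Y _ => le_of_eq (by ring))
        refine hcs.trans (mul_le_mul_of_nonneg_right (hrow X hX) ?_)
        exact Finset.sum_nonneg fun Y _ => mul_nonneg (hb0 X Y) (sq_nonneg _)
    _ = R * ∑ Y ∈ T, (∑ X ∈ T, b X Y) * f Y ^ 2 := by
        rw [← Finset.mul_sum, Finset.sum_comm]
        simp_rw [Finset.sum_mul]
    _ ≤ R * ∑ Y ∈ T, R * f Y ^ 2 := by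
        gcongr with Y hY
        exact hcol Y hY
    _ = R ^ 2 * ∑ Y ∈ T, f Y ^ 2 := by rw [← Finset.mul_sum]; ring

end Blocks

/-! ### Lattice sums -/

lemma summable_int_abs_add_one_rpow {b : ℝ} (hb : 1 < b) :
    Summable fun k : ℤ => (|(k : ℝ)| + 1) ^ (-b) := by
  have h : Summable fun k : ℕ => ((k : ℝ) + 1) ^ (-b) := by
    have := (summable_nat_add_iff 1).2 (Real.summable_nat_rpow.2 (neg_lt_neg hb))
    simpa using this
  refine Summable.of_nat_of_neg ?_ ?_ <;> simpa using h

/-- The sums `∑_y (|x - y| + 1) ^ (-s)` over finite subsets of `ℤ^d` are bounded for `s > d`. As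
`|x - y|` dominates each coordinate, the summand is at most a product of one-dimensional terms with
exponent `s / d > 1`. -/
lemma exists_lattice_sum_le {d : ℕ} (hd : 1 ≤ d) {s : ℝ} (hs : (d : ℝ) < s) :
    ∃ S : ℝ, 1 ≤ S ∧ ∀ (X : Fin d → ℤ) (T : Finset (Fin d → ℤ)),
      ∑ Y ∈ T, (dist X Y + 1) ^ (-s) ≤ S := by
  have hd0 : (0 : ℝ) < d := by exact_mod_cast hd
  have hb : 1 < s / d := by rwa [lt_div_iff₀ hd0, one_mul]
  have hsum := summable_int_abs_add_one_rpow hb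
  set g : ℤ → ℝ := fun k => (|(k : ℝ)| + 1) ^ (-(s / d)) with hg
  have hg0 : ∀ k, 0 ≤ g k := fun k => by positivity
  have h1 : 1 ≤ ∑' k, g k := by
    have := hsum.le_tsum 0 (fun k _ => hg0 k)
    simpa [g] using this
  refine ⟨(∑' k, g k) ^ d, one_le_pow₀ h1, fun X T => ?_⟩
  have hle : ∀ Y : Fin d → ℤ, (dist X Y + 1) ^ (-s) ≤ ∏ i, g (Y i - X i) := by
    intro Y
    have : (dist X Y + 1) ^ (-s) = ∏ _i : Fin d, (dist X Y + 1) ^ (-(s / d)) := by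
      rw [Finset.prod_const, Finset.card_univ, Fintype.card_fin, ← Real.rpow_natCast,
        ← Real.rpow_mul (by positivity)]
      congr 1
      field_simp
    rw [this]
    refine Finset.prod_le_prod (fun i _ => by positivity) fun i _ => ?_
    refine Real.rpow_le_rpow_of_nonpos (by positivity) ?_ (by linarith)
    have := dist_le_pi_dist X Y i
    rw [dist_comm, Int.dist_eq] at this
    push_cast
    linarith
  calc ∑ Y ∈ T, (dist X Y + 1) ^ (-s) ≤ ∑ Y ∈ T, ∏ i, g (Y i - X i) :=
        Finset.sum_le_sum fun Y _ => hle Y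
    _ = ∑ Z ∈ T.image (fun Y => Y - X), ∏ i, g (Z i) := by
        rw [Finset.sum_image (fun a _ b _ h => sub_left_injective h)]
        rfl
    _ ≤ ∑ Z ∈ Fintype.piFinset fun i => (T.image (fun Y => Y - X)).image fun Z => Z i,
          ∏ i, g (Z i) := by
        refine Finset.sum_le_sum_of_subset_of_nonneg (fun Z hZ => ?_)
          fun Z _ _ => Finset.prod_nonneg fun i _ => hg0 _
        exact Fintype.mem_piFinset.2 fun i => Finset.mem_image_of_mem _ hZ
    _ = ∏ i, ∑ k ∈ (T.image (fun Y => Y - X)).image fun Z => Z i, g k := by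
        rw [Finset.prod_univ_sum]
    _ ≤ ∏ _i : Fin d, ∑' k, g k :=
        Finset.prod_le_prod (fun i _ => Finset.sum_nonneg fun k _ => hg0 k)
          fun i _ => hsum.sum_le_tsum _ fun k _ => hg0 k
    _ = (∑' k, g k) ^ d := by simp

/-! ### Matrices with polynomially decaying blocks -/

section Decay

variable {n : Type*} [Fintype n] [DecidableEq n] {d : ℕ} {pos : n → Fin d → ℤ} {α : ℝ}

/-- The blocks of `M` with respect to the labelling `pos` by points of `ℤ^d` decay like
`c (|X - Y| + 1) ^ (-α)`, where `|X - Y|` is the supremum distance. -/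
def BlockDecay (pos : n → Fin d → ℤ) (α c : ℝ) (M : Matrix n n ℂ) : Prop :=
  ∀ X Y, ‖blockProj pos X * M * blockProj pos Y‖ ≤ c * (dist X Y + 1) ^ (-α)

lemma BlockDecay.mono {c c' : ℝ} {M : Matrix n n ℂ} (h : BlockDecay pos α c M) (hc : c ≤ c') :
    BlockDecay pos α c' M :=
  fun X Y => (h X Y).trans (mul_le_mul_of_nonneg_right hc (by positivity))

lemma BlockDecay.sub {a b : ℝ} {A B : Matrix n n ℂ} (hA : BlockDecay pos α a A)
    (hB : BlockDecay pos α b B) : BlockDecay pos α (a + b) (A - B) := fun X Y => by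
  rw [Matrix.mul_sub, Matrix.sub_mul, add_mul]
  exact (norm_sub_le _ _).trans (add_le_add (hA X Y) (hB X Y))

lemma norm_le_of_blockDecay {S c : ℝ} (hc : 0 ≤ c)
    (hS : ∀ (X : Fin d → ℤ) (T : Finset (Fin d → ℤ)), ∑ Y ∈ T, (dist X Y + 1) ^ (-α) ≤ S)
    {M : Matrix n n ℂ} (hM : BlockDecay pos α c M) : ‖M‖ ≤ c * S := by
  have hS0 : 0 ≤ S := by simpa using hS 0 ∅
  refine norm_le_of_schur (T := Finset.univ.image pos)
    (fun i => Finset.mem_image_of_mem _ (Finset.mem_univ i)) (by positivity)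
    (fun X _ => ?_) fun Y _ => ?_
  · refine (Finset.sum_le_sum fun Y _ => hM X Y).trans ?_
    rw [← Finset.mul_sum]
    exact mul_le_mul_of_nonneg_left (hS X _) hc
  · refine (Finset.sum_le_sum fun X _ => hM X Y).trans ?_
    rw [← Finset.mul_sum]
    simp_rw [dist_comm _ Y]
    exact mul_le_mul_of_nonneg_left (hS Y _) hc

lemma rpow_neg_mul_rpow_neg_le {u v w : ℝ} (hα : 0 ≤ α) (hu : 0 < u) (hv : 0 < v) (hw : 0 < w)
    (h : w ≤ u + v) : u ^ (-α) * v ^ (-α) ≤ 2 ^ α * w ^ (-α) * (u ^ (-α) + v ^ (-α)) := by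
  have key : ∀ t : ℝ, 0 < t → w ≤ 2 * t → t ^ (-α) ≤ 2 ^ α * w ^ (-α) := by
    intro t ht hwt
    have : (w / 2) ^ (-α) = 2 ^ α * w ^ (-α) := by
      rw [Real.div_rpow hw.le zero_le_two, Real.rpow_neg zero_le_two, div_inv_eq_mul, mul_comm]
    rw [← this]
    exact Real.rpow_le_rpow_of_nonpos (by positivity) (by linarith) (by linarith)
  have hu' : 0 ≤ u ^ (-α) := by positivity
  have hv' : 0 ≤ v ^ (-α) := by positivity
  have hw' : 0 ≤ 2 ^ α * w ^ (-α) := by positivity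
  rcases le_total u v with huv | huv
  · nlinarith [mul_le_mul_of_nonneg_left (key v hv (by linarith)) hu', mul_nonneg hw' hv']
  · nlinarith [mul_le_mul_of_nonneg_right (key u hu (by linarith)) hv', mul_nonneg hw' hu']

/-- For `α > d` the matrices with `α`-decaying blocks form an algebra: one of the two steps of a
path `X → Z → Y` covers at least half of the distance, and the other one can be summed. -/
lemma BlockDecay.mul {S a b : ℝ} (hα : 0 ≤ α) (ha : 0 ≤ a) (hb : 0 ≤ b)
    (hS : ∀ (X : Fin d → ℤ) (T : Finset (Fin d → ℤ)), ∑ Y ∈ T, (dist X Y + 1) ^ (-α) ≤ S)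
    {A B : Matrix n n ℂ} (hA : BlockDecay pos α a A) (hB : BlockDecay pos α b B) :
    BlockDecay pos α (2 ^ α * 2 * S * a * b) (A * B) := by
  intro X Y
  set T := Finset.univ.image pos
  refine (norm_block_mul_le (T := T) (fun i => Finset.mem_image_of_mem _ (Finset.mem_univ i))
    A B X Y).trans ?_
  calc _ ≤ ∑ Z ∈ T, a * b * (2 ^ α * (dist X Y + 1) ^ (-α)) *
          ((dist X Z + 1) ^ (-α) + (dist Y Z + 1) ^ (-α)) := by
        refine Finset.sum_le_sum fun Z _ => ?_
        calc _ ≤ (a * (dist X Z + 1) ^ (-α)) * (b * (dist Z Y + 1) ^ (-α)) :=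
              mul_le_mul (hA X Z) (hB Z Y) (norm_nonneg _) (by positivity)
          _ = a * b * ((dist X Z + 1) ^ (-α) * (dist Y Z + 1) ^ (-α)) := by
              rw [dist_comm Z Y]; ring
          _ ≤ a * b * (2 ^ α * (dist X Y + 1) ^ (-α) *
                ((dist X Z + 1) ^ (-α) + (dist Y Z + 1) ^ (-α))) := by
              refine mul_le_mul_of_nonneg_left ?_ (by positivity)
              refine rpow_neg_mul_rpow_neg_le hα (by positivity) (by positivity) (by positivity) ?_
              have := dist_triangle_right X Y Z
              linarith
          _ = _ := by ring
    _ = a * b * (2 ^ α * (dist X Y + 1) ^ (-α)) *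
          (∑ Z ∈ T, (dist X Z + 1) ^ (-α) + ∑ Z ∈ T, (dist Y Z + 1) ^ (-α)) := by
        rw [← Finset.mul_sum, Finset.sum_add_distrib]
    _ ≤ a * b * (2 ^ α * (dist X Y + 1) ^ (-α)) * (S + S) := by
        gcongr
        · exact hS X T
        · exact hS Y T
    _ = _ := by ring

/-! ### Coarse-graining -/

/-- The index of the cube of side `L` that contains the lattice point `x`. -/
def cell (L : ℕ) (x : Fin d → ℤ) : Fin d → ℤ := fun i => x i / (L : ℤ)

lemma dist_cell_le {L : ℕ} (hL : 1 ≤ L) (x y : Fin d → ℤ) :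
    L * (dist (cell L x) (cell L y) - 1) ≤ dist x y := by
  have hL0 : (0 : ℝ) < L := by exact_mod_cast hL
  suffices h : dist (cell L x) (cell L y) ≤ dist x y / L + 1 by
    have := mul_le_mul_of_nonneg_left h hL0.le
    rw [mul_add, mul_div_cancel₀ _ hL0.ne'] at this
    linarith
  refine (dist_pi_le_iff (by positivity)).2 fun i => ?_
  have hi := dist_le_pi_dist x y i
  rw [Int.dist_eq] at hi ⊢
  have h1 : |x i / (L : ℤ) - y i / (L : ℤ)| * L ≤ |x i - y i| + L := by
    have hL' : (0 : ℤ) < L := by exact_mod_cast hL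
    have e1 := Int.mul_ediv_add_emod (x i) L
    have e2 := Int.mul_ediv_add_emod (y i) L
    have b1 := Int.emod_nonneg (x i) hL'.ne'
    have b2 := Int.emod_nonneg (y i) hL'.ne'
    have c1 := Int.emod_lt_of_pos (x i) hL'
    have c2 := Int.emod_lt_of_pos (y i) hL'
    rcases abs_cases (x i / (L : ℤ) - y i / (L : ℤ)) with h | h <;>
      rcases abs_cases (x i - y i) with h' | h' <;> rw [h.1, h'.1] <;> nlinarith
  have h2 : |((x i / (L : ℤ) : ℤ) : ℝ) - ((y i / (L : ℤ) : ℤ) : ℝ)| * L ≤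
      |(x i : ℝ) - y i| + L := by exact_mod_cast h1
  rw [← sub_le_iff_le_add, le_div_iff₀ hL0, sub_mul, one_mul]
  change |((x i / (L : ℤ) : ℤ) : ℝ) - ((y i / (L : ℤ) : ℤ) : ℝ)| * L - L ≤ _
  linarith

lemma dist_add_one_le {L : ℕ} (hL : 1 ≤ L) (x y : Fin d → ℤ) :
    dist x y + 1 ≤ L * (dist (cell L x) (cell L y) + 1) := by
  have hL1 : (1 : ℝ) ≤ L := by exact_mod_cast hL
  have hD := dist_nonneg (x := cell L x) (y := cell L y)
  suffices h : dist x y ≤ L * (dist (cell L x) (cell L y) + 1) - 1 by linarith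
  refine (dist_pi_le_iff (by nlinarith)).2 fun i => ?_
  have hi := dist_le_pi_dist (cell L x) (cell L y) i
  rw [Int.dist_eq] at hi ⊢
  have h1 : |x i - y i| ≤ L * (|x i / (L : ℤ) - y i / (L : ℤ)| + 1) - 1 := by
    have hL' : (0 : ℤ) < L := by exact_mod_cast hL
    have e1 := Int.mul_ediv_add_emod (x i) L
    have e2 := Int.mul_ediv_add_emod (y i) L
    have b1 := Int.emod_nonneg (x i) hL'.ne'
    have b2 := Int.emod_nonneg (y i) hL'.ne'
    have c1 := Int.emod_lt_of_pos (x i) hL'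
    have c2 := Int.emod_lt_of_pos (y i) hL'
    rcases abs_cases (x i / (L : ℤ) - y i / (L : ℤ)) with h | h <;>
      rcases abs_cases (x i - y i) with h' | h' <;> rw [h.1, h'.1] <;> nlinarith
  have h2 : |(x i : ℝ) - y i| ≤
      L * (|((x i / (L : ℤ) : ℤ) : ℝ) - ((y i / (L : ℤ) : ℤ) : ℝ)| + 1) - 1 := by
    exact_mod_cast h1
  have h3 := mul_le_mul_of_nonneg_left hi (zero_le_one.trans hL1)
  change (L : ℝ) * |((x i / (L : ℤ) : ℤ) : ℝ) - ((y i / (L : ℤ) : ℤ) : ℝ)| ≤ _ at h3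
  linarith

lemma card_filter_cell_le {L : ℕ} (hL : 1 ≤ L) (T : Finset (Fin d → ℤ)) (Y : Fin d → ℤ) :
    (T.filter fun y => cell L y = Y).card ≤ L ^ d := by
  have hL' : (0 : ℤ) < L := by exact_mod_cast hL
  have hsub : (T.filter fun y => cell L y = Y) ⊆
      Finset.Icc (fun i => L * Y i) (fun i => L * Y i + L - 1) := by
    intro y hy
    have hy' := (Finset.mem_filter.1 hy).2
    rw [Finset.mem_Icc, Pi.le_def, Pi.le_def]
    have : ∀ i, y i / (L : ℤ) = Y i := fun i => congrFun hy' i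
    constructor <;> intro i <;> rw [← this i] <;>
      have e := Int.mul_ediv_add_emod (y i) L <;>
      have b := Int.emod_nonneg (y i) hL'.ne' <;>
      have c := Int.emod_lt_of_pos (y i) hL' <;> linarith
  refine (Finset.card_le_card hsub).trans ?_
  rw [Pi.card_Icc]
  simp

lemma blockProj_mul_blockProj_cell (L : ℕ) (x : Fin d → ℤ) :
    blockProj pos x * blockProj (cell L ∘ pos) (cell L x) = blockProj pos x := by
  rw [blockProj, blockProj, Matrix.diagonal_mul_diagonal]
  congr 1
  ext i
  by_cases h : pos i = x <;> simp [h]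

lemma blockProj_cell_mul_blockProj (L : ℕ) (x : Fin d → ℤ) :
    blockProj (cell L ∘ pos) (cell L x) * blockProj pos x = blockProj pos x := by
  rw [blockProj, blockProj, Matrix.diagonal_mul_diagonal]
  congr 1
  ext i
  by_cases h : pos i = x <;> simp [h]

/-- After grouping the sites into cubes of side `L`, the blocks of an `α`-decaying matrix still
decay like the power `-α` of the distance, now with a constant that is small if the operator norm
of the matrix is small and `L` is large: between distant cubes, the Schur test loses the number
`L ^ d` of sites of a cube, while the distance gains a factor `L`. -/
lemma BlockDecay.coarse {L : ℕ} (hL : 1 ≤ L) {J η : ℝ} (hα : 0 ≤ α) (hJ : 0 ≤ J)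
    {M : Matrix n n ℂ} (hM : BlockDecay pos α J M) (hη : ‖M‖ ≤ η) :
    BlockDecay (cell L ∘ pos) α (3 ^ α * (η + J * (L : ℝ) ^ ((d : ℝ) - α))) M := by
  intro X Y
  have hL0 : (0 : ℝ) < L := by exact_mod_cast hL
  have hη0 : 0 ≤ η := (norm_nonneg _).trans hη
  set D := dist X Y with hD
  have hD0 : 0 ≤ D := dist_nonneg
  have h3 : ((D + 1) / 3) ^ (-α) = 3 ^ α * (D + 1) ^ (-α) := by
    rw [Real.div_rpow (by positivity) (by positivity), Real.rpow_neg (by positivity : (0:ℝ) ≤ 3),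
      div_inv_eq_mul, mul_comm]
  rcases lt_or_ge D 2 with h | h
  · calc _ ≤ η * 1 := by rw [mul_one]; exact (norm_block_le _ _ _).trans hη
      _ ≤ η * ((D + 1) / 3) ^ (-α) := by
          gcongr
          exact Real.one_le_rpow_of_pos_of_le_one_of_nonpos (by positivity) (by linarith)
            (by linarith)
      _ = 3 ^ α * η * (D + 1) ^ (-α) := by rw [h3]; ring
      _ ≤ _ := by
          gcongr
          exact le_add_of_nonneg_right (by positivity)
  · set c := J * (L * ((D + 1) / 3)) ^ (-α) with hc
    have hc0 : 0 ≤ c := by positivity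
    have hent : ∀ x y, ‖blockProj pos x * (blockProj (cell L ∘ pos) X * M *
        blockProj (cell L ∘ pos) Y) * blockProj pos y‖ ≤
          if cell L x = X ∧ cell L y = Y then c else 0 := by
      intro x y
      by_cases hxy : cell L x = X ∧ cell L y = Y
      · rw [if_pos hxy, ← hxy.1, ← hxy.2]
        have : blockProj pos x * (blockProj (cell L ∘ pos) (cell L x) * M *
            blockProj (cell L ∘ pos) (cell L y)) * blockProj pos y =
            blockProj pos x * M * blockProj pos y := by
          rw [← blockProj_mul_blockProj_cell (pos := pos) L x,
            ← blockProj_cell_mul_blockProj (pos := pos) L y]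
          simp only [← Matrix.mul_assoc]
          rw [Matrix.mul_assoc _ (blockProj (cell L ∘ pos) _) (blockProj (cell L ∘ pos) _),
            Matrix.mul_assoc _ (blockProj (cell L ∘ pos) _) (blockProj (cell L ∘ pos) _)]
          simp only [blockProj_mul_self]
        rw [this]
        refine (hM x y).trans (mul_le_mul_of_nonneg_left ?_ hJ)
        refine Real.rpow_le_rpow_of_nonpos (by positivity) ?_ (by linarith)
        have := dist_cell_le hL x y
        rw [hxy.1, hxy.2, ← hD] at this
        nlinarith
      · rw [if_neg hxy]
        refine le_of_eq (norm_eq_zero.2 ?_)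
        ext i j
        rw [block_apply, block_apply, Matrix.zero_apply]
        by_cases hij : pos i = x ∧ pos j = y
        · rw [if_pos hij, if_neg]
          rw [Function.comp, Function.comp, hij.1, hij.2]
          exact hxy
        · rw [if_neg hij]
    have hsum : ∀ (T : Finset (Fin d → ℤ)) (Z : Fin d → ℤ),
        ∑ z ∈ T, (if cell L z = Z then c else 0) ≤ (L : ℝ) ^ d * c := by
      intro T Z
      rw [← Finset.sum_filter, Finset.sum_const, nsmul_eq_mul]
      refine mul_le_mul_of_nonneg_right ?_ hc0
      exact_mod_cast card_filter_cell_le hL T Z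
    have hnorm : ‖blockProj (cell L ∘ pos) X * M * blockProj (cell L ∘ pos) Y‖ ≤
        (L : ℝ) ^ d * c := by
      refine norm_le_of_schur (pos := pos) (T := Finset.univ.image pos)
        (fun i => Finset.mem_image_of_mem _ (Finset.mem_univ i)) (by positivity)
        (fun x _ => ?_) fun y _ => ?_
      · refine (Finset.sum_le_sum fun y _ => (hent x y).trans ?_).trans (hsum _ Y)
        by_cases h1 : cell L x = X <;> by_cases h2 : cell L y = Y <;> simp [h1, h2, hc0]
      · refine (Finset.sum_le_sum fun x _ => (hent x y).trans ?_).trans (hsum _ X)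
        by_cases h1 : cell L x = X <;> by_cases h2 : cell L y = Y <;> simp [h1, h2, hc0]
    refine hnorm.trans ?_
    have : (L : ℝ) ^ d * c = 3 ^ α * (J * (L : ℝ) ^ ((d : ℝ) - α)) * (D + 1) ^ (-α) := by
      rw [hc, Real.mul_rpow hL0.le (by positivity), h3, sub_eq_add_neg, Real.rpow_add hL0,
        Real.rpow_natCast]
      ring
    rw [this]
    gcongr
    exact le_add_of_nonneg_left hη0

end Decay

/-! ### Perturbation of inverses and the Combes–Thomas estimate -/

section Perturbation

variable {R : Type*} [NormedRing R]

lemma norm_le_of_perturbed_inverse {A A' E B : R} {a : ℝ} (hA : A' * A = 1)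
    (hB : (A + E) * B = 1) (ha : ‖A'‖ ≤ a) (hE : ‖E‖ * a ≤ 1 / 2) : ‖B‖ ≤ 2 * a := by
  have h : B = A' - A' * E * B := by
    calc B = A' * A * B := by rw [hA, one_mul]
      _ = A' * ((A + E) * B) - A' * E * B := by noncomm_ring
      _ = A' - A' * E * B := by rw [hB, mul_one]
  have h1 : ‖B‖ ≤ a + 1 / 2 * ‖B‖ := by
    calc ‖B‖ = ‖A' - A' * E * B‖ := by rw [← h]
      _ ≤ ‖A'‖ + ‖A'‖ * ‖E‖ * ‖B‖ := by
          refine (norm_sub_le _ _).trans (add_le_add le_rfl ?_)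
          exact (norm_mul_le _ _).trans (mul_le_mul_of_nonneg_right (norm_mul_le _ _)
            (norm_nonneg _))
      _ ≤ a + (‖E‖ * a) * ‖B‖ := by
          rw [mul_comm ‖E‖]
          gcongr
      _ ≤ _ := by gcongr
  linarith

lemma exists_perturbed_inverse [CompleteSpace R] {A A' E : R} {a : ℝ} (hA' : A * A' = 1)
    (ha : ‖A'‖ ≤ a) (hE : ‖E‖ * a ≤ 1 / 2) : ∃ B, (A + E) * B = 1 := by
  have hlt : ‖-(A' * E)‖ < 1 := by
    rw [norm_neg]
    calc ‖A' * E‖ ≤ ‖A'‖ * ‖E‖ := norm_mul_le _ _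
      _ ≤ a * ‖E‖ := by gcongr
      _ < 1 := by linarith
  obtain ⟨u, hu⟩ := isUnit_one_sub_of_norm_lt_one hlt
  refine ⟨(↑u⁻¹ : R) * A', ?_⟩
  have : A + E = A * u := by
    rw [hu, sub_neg_eq_add, mul_add, mul_one, ← mul_assoc, hA', one_mul]
  rw [this, ← mul_assoc, mul_assoc A, u.mul_inv, mul_one, hA']

end Perturbation

section Resolvent

variable {n : Type*} [Fintype n] [DecidableEq n] {d : ℕ} {pos : n → Fin d → ℤ} {α : ℝ}

lemma exists_exp_neg_le_rpow (α : ℝ) :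
    ∃ c : ℝ, 1 ≤ c ∧ ∀ D : ℝ, 0 ≤ D → Real.exp (2 - D) ≤ c * (D + 1) ^ (-α) := by
  set k := ⌈α⌉₊
  have h1 : (1 : ℝ) ≤ k.factorial := by exact_mod_cast k.factorial_pos
  refine ⟨k.factorial * Real.exp 3, one_le_mul_of_one_le_of_one_le h1
    (Real.one_le_exp (by norm_num)), fun D hD => ?_⟩
  have h2 : (D + 1) ^ α ≤ k.factorial * Real.exp (D + 1) := by
    calc (D + 1) ^ α ≤ (D + 1) ^ (k : ℝ) :=
          Real.rpow_le_rpow_of_exponent_le (by linarith) (Nat.le_ceil α)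
      _ = (D + 1) ^ k := Real.rpow_natCast _ _
      _ ≤ _ := by
          have := Real.pow_div_factorial_le_exp (D + 1) (by linarith) k
          rwa [div_le_iff₀ (by positivity), mul_comm] at this
  rw [Real.rpow_neg (by positivity), ← div_eq_mul_inv, le_div_iff₀ (by positivity)]
  calc Real.exp (2 - D) * (D + 1) ^ α
      ≤ Real.exp (2 - D) * (k.factorial * Real.exp (D + 1)) := by gcongr
    _ = k.factorial * Real.exp 3 := by
        rw [mul_left_comm, ← Real.exp_add]; ring_nf

/-- **Combes–Thomas estimate**: the inverse of a matrix of range `χ` decays exponentially.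
Conjugation with the exponential of `κ / χ` times the distance from a point changes the matrix by a
small amount, so the conjugated inverse is still bounded. -/
lemma norm_block_inverse_le_exp {S J χ κ a : ℝ} {L : ℕ} (hL : 1 ≤ L) (hJ : 0 ≤ J)
    (hS : ∀ (X : Fin d → ℤ) (T : Finset (Fin d → ℤ)), ∑ Y ∈ T, (dist X Y + 1) ^ (-α) ≤ S)
    (hχ : 0 < χ) (hκ0 : 0 ≤ κ) (hκ1 : κ ≤ 1) {M G : Matrix n n ℂ} {z : ℂ}
    (hM : BlockDecay pos α J M) (hrange : ∀ i j, χ < dist (pos i) (pos j) → M i j = 0)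
    (hG : (M - z • 1) * G = 1) (ha : ‖G‖ ≤ a) (hκ : 2 * κ * J * S * a ≤ 1 / 2)
    (X Y : Fin d → ℤ) :
    ‖blockProj (cell L ∘ pos) X * G * blockProj (cell L ∘ pos) Y‖ ≤
      2 * a * Real.exp (-(κ * L / χ * (dist X Y - 2))) := by
  have ha0 : 0 ≤ a := (norm_nonneg _).trans ha
  by_cases hY : ∀ i, (cell L ∘ pos) i ≠ Y
  · rw [block_eq_zero (Or.inr hY), norm_zero]
    positivity
  push Not at hY
  obtain ⟨i₀, hi₀⟩ := hY
  set x₀ := pos i₀ with hx₀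
  set φ : (Fin d → ℤ) → ℝ := fun x => dist x x₀ / χ with hφ
  set W : Matrix n n ℂ := Matrix.diagonal fun i => (Real.exp (κ * φ (pos i)) : ℂ) with hW
  set W' : Matrix n n ℂ := Matrix.diagonal fun i => (Real.exp (-(κ * φ (pos i))) : ℂ) with hW'
  have hWW' : W * W' = 1 := by
    rw [hW, hW', Matrix.diagonal_mul_diagonal, ← Matrix.diagonal_one]
    congr 1
    ext i
    rw [← Complex.ofReal_mul, ← Real.exp_add]
    simp
  have hW'W : W' * W = 1 := mul_eq_one_comm.1 hWW'
  set E := W * M * W' - M with hE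
  have hEbd : BlockDecay pos α (2 * κ * J) E := by
    intro x y
    have hblk : blockProj pos x * E * blockProj pos y =
        ((Real.exp (κ * (φ x - φ y)) - 1 : ℝ) : ℂ) • (blockProj pos x * M * blockProj pos y) := by
      ext i j
      rw [block_apply, Matrix.smul_apply, block_apply]
      by_cases h : pos i = x ∧ pos j = y
      · rw [if_pos h, if_pos h, hE, hW, hW', Matrix.sub_apply, Matrix.mul_diagonal,
          Matrix.diagonal_mul, h.1, h.2, mul_sub, sub_eq_add_neg (κ * φ x), Real.exp_add]
        push_cast
        rw [smul_eq_mul]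
        ring
      · rw [if_neg h, if_neg h, smul_zero]
    rw [hblk, norm_smul, Complex.norm_real, Real.norm_eq_abs]
    rcases le_or_gt (dist x y) χ with h | h
    · have hlip : |κ * (φ x - φ y)| ≤ κ := by
        rw [abs_mul, abs_of_nonneg hκ0]
        refine mul_le_of_le_one_right hκ0 ?_
        rw [hφ, ← sub_div, abs_div, abs_of_pos hχ, div_le_one hχ]
        exact (abs_dist_sub_le x y x₀).trans h
      calc _ ≤ (2 * κ) * (J * (dist x y + 1) ^ (-α)) := by
            refine mul_le_mul ?_ (hM x y) (norm_nonneg _) (by positivity)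
            exact (Real.abs_exp_sub_one_le (hlip.trans hκ1)).trans (by linarith)
        _ = _ := by ring
    · have : blockProj pos x * M * blockProj pos y = 0 := by
        ext i j
        rw [block_apply, Matrix.zero_apply]
        by_cases hij : pos i = x ∧ pos j = y
        · rw [if_pos hij]
          refine hrange i j ?_
          rwa [hij.1, hij.2]
        · rw [if_neg hij]
      rw [this, norm_zero, mul_zero]
      positivity
  have hEn : ‖E‖ ≤ 2 * κ * J * S := norm_le_of_blockDecay (by positivity) hS hEbd
  have hconj : ((M - z • 1) + E) * (W * G * W') = 1 := by
    have h1 : (M - z • 1) + E = W * (M - z • 1) * W' := by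
      rw [hE, Matrix.mul_sub, Matrix.sub_mul, Matrix.mul_smul, Matrix.smul_mul, Matrix.mul_one,
        hWW']
      abel
    calc _ = W * (M - z • 1) * (W' * W) * G * W' := by rw [h1]; simp only [Matrix.mul_assoc]
      _ = W * ((M - z • 1) * G) * W' := by rw [hW'W, Matrix.mul_one]; simp only [Matrix.mul_assoc]
      _ = 1 := by rw [hG, Matrix.mul_one, hWW']
  have hbd : ‖W * G * W'‖ ≤ 2 * a :=
    norm_le_of_perturbed_inverse (mul_eq_one_comm.1 hG) hconj ha
      ((mul_le_mul_of_nonneg_right hEn ha0).trans hκ)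
  have hleft : ‖blockProj (cell L ∘ pos) X * W'‖ ≤
      Real.exp (-(κ * (L * (dist X Y - 1) / χ))) := by
    rw [hW', blockProj, Matrix.diagonal_mul_diagonal, Matrix.l2_opNorm_diagonal,
      pi_norm_le_iff_of_nonneg (Real.exp_pos _).le]
    intro i
    by_cases h : (cell L ∘ pos) i = X
    · rw [if_pos h, one_mul, Complex.norm_real, Real.norm_eq_abs, abs_of_pos (Real.exp_pos _),
        Real.exp_le_exp, neg_le_neg_iff]
      have := dist_cell_le hL (pos i) x₀
      rw [show cell L (pos i) = X from h, show cell L x₀ = Y from hi₀] at this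
      exact mul_le_mul_of_nonneg_left (div_le_div_of_nonneg_right this hχ.le) hκ0
    · rw [if_neg h, zero_mul, norm_zero]
      positivity
  have hright : ‖W * blockProj (cell L ∘ pos) Y‖ ≤ Real.exp (κ * (L / χ)) := by
    rw [hW, blockProj, Matrix.diagonal_mul_diagonal, Matrix.l2_opNorm_diagonal,
      pi_norm_le_iff_of_nonneg (Real.exp_pos _).le]
    intro i
    by_cases h : (cell L ∘ pos) i = Y
    · rw [if_pos h, mul_one, Complex.norm_real, Real.norm_eq_abs, abs_of_pos (Real.exp_pos _),
        Real.exp_le_exp]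
      have := dist_add_one_le hL (pos i) x₀
      rw [show cell L (pos i) = Y from h, show cell L x₀ = Y from hi₀, dist_self] at this
      exact mul_le_mul_of_nonneg_left (div_le_div_of_nonneg_right (by linarith) hχ.le) hκ0
    · rw [if_neg h, mul_zero, norm_zero]
      positivity
  have hfac : blockProj (cell L ∘ pos) X * G * blockProj (cell L ∘ pos) Y =
      (blockProj (cell L ∘ pos) X * W') * (W * G * W') * (W * blockProj (cell L ∘ pos) Y) := by
    calc _ = blockProj (cell L ∘ pos) X * (W' * W) * G * (W' * W) * blockProj (cell L ∘ pos) Y := by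
          rw [hW'W, Matrix.mul_one, Matrix.mul_one]
      _ = _ := by simp only [Matrix.mul_assoc]
  rw [hfac]
  calc _ ≤ ‖blockProj (cell L ∘ pos) X * W'‖ * ‖W * G * W'‖ *
          ‖W * blockProj (cell L ∘ pos) Y‖ :=
        (norm_mul_le _ _).trans (mul_le_mul_of_nonneg_right (norm_mul_le _ _) (norm_nonneg _))
    _ ≤ Real.exp (-(κ * (L * (dist X Y - 1) / χ))) * (2 * a) * Real.exp (κ * (L / χ)) := by
        gcongr
    _ = 2 * a * (Real.exp (-(κ * (L * (dist X Y - 1) / χ))) * Real.exp (κ * (L / χ))) := by ring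
    _ = _ := by
        rw [← Real.exp_add]
        congr 2
        ring

lemma BlockDecay.of_combesThomas {S J χ κ a c : ℝ} {L : ℕ} (hL : 1 ≤ L) (hJ : 0 ≤ J)
    (hS : ∀ (X : Fin d → ℤ) (T : Finset (Fin d → ℤ)), ∑ Y ∈ T, (dist X Y + 1) ^ (-α) ≤ S)
    (hχ : 0 < χ) (hκ0 : 0 ≤ κ) (hκ1 : κ ≤ 1) {M G : Matrix n n ℂ} {z : ℂ}
    (hM : BlockDecay pos α J M) (hrange : ∀ i j, χ < dist (pos i) (pos j) → M i j = 0)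
    (hG : (M - z • 1) * G = 1) (ha : ‖G‖ ≤ a) (hκ : 2 * κ * J * S * a ≤ 1 / 2)
    (hLχ : χ ≤ κ * L) (hc : ∀ D : ℝ, 0 ≤ D → Real.exp (2 - D) ≤ c * (D + 1) ^ (-α)) :
    BlockDecay (cell L ∘ pos) α (2 * a * c) G := by
  intro X Y
  have ha0 : 0 ≤ a := (norm_nonneg _).trans ha
  rw [mul_assoc (2 * a)]
  refine le_trans ?_ (mul_le_mul_of_nonneg_left (hc (dist X Y) dist_nonneg) (by positivity))
  rcases lt_or_ge (dist X Y) 2 with h | h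
  · refine (norm_block_le _ _ _).trans (ha.trans ?_)
    have : 1 ≤ Real.exp (2 - dist X Y) := Real.one_le_exp (by linarith)
    nlinarith
  · refine (norm_block_inverse_le_exp hL hJ hS hχ hκ0 hκ1 hM hrange hG ha hκ X Y).trans ?_
    refine mul_le_mul_of_nonneg_left (Real.exp_le_exp.2 ?_) (by positivity)
    have : 1 ≤ κ * L / χ := by rwa [one_le_div hχ]
    nlinarith

/-! ### Decay of resolvents -/

/-- The part of `M` that connects sites at distance at most `χ`. -/
def shortRange (pos : n → Fin d → ℤ) (χ : ℝ) (M : Matrix n n ℂ) : Matrix n n ℂ :=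
  Matrix.of fun i j => if dist (pos i) (pos j) ≤ χ then M i j else 0

lemma block_shortRange (χ : ℝ) (M : Matrix n n ℂ) (X Y : Fin d → ℤ) :
    blockProj pos X * shortRange pos χ M * blockProj pos Y =
      if dist X Y ≤ χ then blockProj pos X * M * blockProj pos Y else 0 := by
  ext i j
  rw [block_apply]
  by_cases h : pos i = X ∧ pos j = Y
  · rw [if_pos h, shortRange, Matrix.of_apply, h.1, h.2]
    by_cases hd : dist X Y ≤ χ
    · rw [if_pos hd, if_pos hd, block_apply, if_pos h]
    · rw [if_neg hd, if_neg hd, Matrix.zero_apply]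
  · rw [if_neg h]
    by_cases hd : dist X Y ≤ χ
    · rw [if_pos hd, block_apply, if_neg h]
    · rw [if_neg hd, Matrix.zero_apply]

lemma BlockDecay.shortRange {J : ℝ} (χ : ℝ) {M : Matrix n n ℂ} (hM : BlockDecay pos α J M) :
    BlockDecay pos α J (shortRange pos χ M) := by
  intro X Y
  rw [block_shortRange]
  split_ifs with h
  · exact hM X Y
  · rw [norm_zero]
    exact (norm_nonneg _).trans (hM X Y)

lemma BlockDecay.longRange {J : ℝ} (χ : ℝ) {M : Matrix n n ℂ} (hM : BlockDecay pos α J M) :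
    BlockDecay pos α J (M - FreeFermion.shortRange pos χ M) := by
  intro X Y
  rw [Matrix.mul_sub, Matrix.sub_mul, block_shortRange]
  split_ifs with h
  · rw [sub_self, norm_zero]
    exact (norm_nonneg _).trans (hM X Y)
  · rw [sub_zero]
    exact hM X Y

lemma norm_longRange_le {J S χ β : ℝ} (hJ : 0 ≤ J) (hχ : 0 < χ) (hβ : 0 ≤ β)
    (hS : ∀ (X : Fin d → ℤ) (T : Finset (Fin d → ℤ)), ∑ Y ∈ T, (dist X Y + 1) ^ (-(α - β)) ≤ S)
    {M : Matrix n n ℂ} (hM : BlockDecay pos α J M) :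
    ‖M - shortRange pos χ M‖ ≤ J * χ ^ (-β) * S := by
  refine norm_le_of_blockDecay (pos := pos) (by positivity) hS fun X Y => ?_
  rw [Matrix.mul_sub, Matrix.sub_mul, block_shortRange]
  split_ifs with h
  · rw [sub_self, norm_zero]
    positivity
  · rw [sub_zero]
    refine (hM X Y).trans ?_
    rw [mul_assoc]
    refine mul_le_mul_of_nonneg_left ?_ hJ
    rw [show -α = -β + -(α - β) by ring, Real.rpow_add (by positivity)]
    refine mul_le_mul_of_nonneg_right ?_ (by positivity)
    exact Real.rpow_le_rpow_of_nonpos hχ (by push Not at h; linarith) (by linarith)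

lemma exists_blockDecay (pos : n → Fin d → ℤ) (α : ℝ) (G : Matrix n n ℂ) :
    ∃ m, 0 ≤ m ∧ BlockDecay pos α m G := by
  set T := Finset.univ.image pos
  refine ⟨‖G‖ * ∑ X ∈ T, ∑ Y ∈ T, (dist X Y + 1) ^ α, by positivity, fun X Y => ?_⟩
  by_cases hX : X ∈ T
  · by_cases hY : Y ∈ T
    · refine (norm_block_le _ _ _).trans ?_
      rw [mul_assoc]
      refine le_mul_of_one_le_right (norm_nonneg _) ?_
      rw [Real.rpow_neg (by positivity), ← div_eq_mul_inv, one_le_div (by positivity)]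
      calc (dist X Y + 1) ^ α ≤ ∑ Y ∈ T, (dist X Y + 1) ^ α :=
            Finset.single_le_sum (f := fun Y => (dist X Y + 1) ^ α)
              (fun _ _ => by positivity) hY
        _ ≤ _ := Finset.single_le_sum (f := fun X => ∑ Y ∈ T, (dist X Y + 1) ^ α)
              (fun _ _ => by positivity) hX
    · rw [block_eq_zero (Or.inr fun i hi => hY (by
        rw [← hi]; exact Finset.mem_image_of_mem _ (Finset.mem_univ i))), norm_zero]
      positivity
  · rw [block_eq_zero (Or.inl fun i hi => hX (by
      rw [← hi]; exact Finset.mem_image_of_mem _ (Finset.mem_univ i))), norm_zero]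
    positivity

/-- Solves the self-consistent estimate `m ≤ c + m / 2` for the decay constant of `G`; this is
possible because a finite matrix decays with some constant. -/
lemma blockDecay_of_halving {G : Matrix n n ℂ} {c : ℝ} (hc : 0 ≤ c)
    (h : ∀ m, 0 ≤ m → BlockDecay pos α m G → BlockDecay pos α (c + m / 2) G) :
    BlockDecay pos α (2 * c) G := by
  obtain ⟨m, hm0, hm⟩ := exists_blockDecay pos α G
  have hk : ∀ k : ℕ, BlockDecay pos α (2 * c + m * (1 / 2) ^ k) G := by
    intro k
    induction k with
    | zero => exact hm.mono (by simp; linarith)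
    | succ k ih =>
      refine (h _ (by positivity) ih).mono (le_of_eq ?_)
      rw [pow_succ]
      ring
  intro X Y
  have hlim : Filter.Tendsto (fun k : ℕ => (2 * c + m * (1 / 2 : ℝ) ^ k) * (dist X Y + 1) ^ (-α))
      Filter.atTop (nhds ((2 * c + m * 0) * (dist X Y + 1) ^ (-α))) :=
    (((tendsto_pow_atTop_nhds_zero_of_lt_one (by norm_num) (by norm_num)).const_mul m).const_add
      (2 * c)).mul_const _
  rw [mul_zero, add_zero] at hlim
  exact ge_of_tendsto' hlim fun k => hk k X Y

/-- Decay of inverses of `α`-decaying matrices. If `‖G‖ ≤ a ≤ 1 / Δ` for the inverse `G` of `H - z`,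
then `G` decays with the power `-α` of the distance on the length scale `L`, and `L` grows at most
polynomially in `1 / Δ`. The range `χ` is taken so large that the long-range part of `H` is a small
perturbation in the algebra of `α`-decaying matrices over the cubes of side `L`, and `L` so large
compared to `χ` that the exponential decay of the inverse of the short-range part is visible. -/
theorem exists_resolvent_blockDecay (hd : 1 ≤ d) (hα : (d : ℝ) < α) {J : ℝ} (hJ : 0 < J) {S : ℝ}
    (hS1 : 1 ≤ S)
    (hS : ∀ (X : Fin d → ℤ) (T : Finset (Fin d → ℤ)), ∑ Y ∈ T, (dist X Y + 1) ^ (-α) ≤ S)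
    {β : ℝ} (hβ0 : 0 < β) (hβ : β < α - d) :
    ∃ C : ℝ, 0 < C ∧ ∀ Δ : ℝ, 0 < Δ → Δ ≤ J * S → ∃ L : ℕ, 1 ≤ L ∧
      (L : ℝ) ≤ C * Δ ^ (-(1 + 1 / β)) ∧
      ∀ (n : Type) [Fintype n] [DecidableEq n] (pos : n → Fin d → ℤ) (H G : Matrix n n ℂ)
        (z : ℂ) (a : ℝ), BlockDecay pos α J H → (H - z • 1) * G = 1 → ‖G‖ ≤ a → a * Δ ≤ 1 →
        BlockDecay (cell L ∘ pos) α (C * a) G := by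
  have hα0 : 0 ≤ α := (Nat.cast_nonneg d).trans hα.le
  obtain ⟨S', hS'1, hS'⟩ := exists_lattice_sum_le hd (s := α - β) (by linarith)
  obtain ⟨c, hc1, hc⟩ := exists_exp_neg_le_rpow α
  set K : ℝ := 2 ^ α * 2 * S with hK
  have hK0 : 0 < K := by positivity
  -- The three summands of `A` ensure, in turn, that the long-range part is small in the algebra of
  -- decaying matrices, that it is small in operator norm, and that `χ ≥ 1`.
  set A : ℝ := 8 * K ^ 2 * c * 3 ^ α * J * (S' + 1) + 2 * J * S' + J * S with hA
  have hA1 : 8 * K ^ 2 * c * 3 ^ α * J * (S' + 1) ≤ A := by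
    have : 0 ≤ 2 * J * S' + J * S := by positivity
    linarith
  have hA2 : 2 * J * S' ≤ A := by
    have : 0 ≤ 8 * K ^ 2 * c * 3 ^ α * J * (S' + 1) + J * S := by positivity
    linarith
  have hA3 : J * S ≤ A := by
    have : 0 ≤ 8 * K ^ 2 * c * 3 ^ α * J * (S' + 1) + 2 * J * S' := by positivity
    linarith
  have hA0 : 0 < A := by positivity
  refine ⟨16 * J * S * A ^ (1 / β) + 8 * c, by positivity, fun Δ hΔ hΔJ => ?_⟩
  set χ : ℝ := (A / Δ) ^ (1 / β) with hχ
  -- With this `κ` the conjugation in the Combes–Thomas estimate costs at most a quarter of the gap.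
  set κ : ℝ := Δ / (8 * J * S) with hκ
  have hχ1 : 1 ≤ χ := Real.one_le_rpow (by rw [one_le_div hΔ]; linarith) (by positivity)
  have hχ0 : 0 < χ := by positivity
  have hχβ : χ ^ (-β) = Δ / A := by
    rw [hχ, ← Real.rpow_mul (by positivity), show 1 / β * -β = -1 by field_simp,
      Real.rpow_neg_one, inv_div]
  have hκ0 : 0 < κ := by positivity
  have hκ1 : κ ≤ 1 := by
    rw [hκ, div_le_one (by positivity)]
    have : 0 < J * S := by positivity
    linarith
  have hχκ : χ ≤ χ / κ := le_div_self hχ0.le hκ0 hκ1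
  set L : ℕ := ⌈χ / κ⌉₊ with hL
  have hLge : χ / κ ≤ L := Nat.le_ceil _
  have hL1 : (1 : ℝ) ≤ L := hχ1.trans (hχκ.trans hLge)
  have hL1' : 1 ≤ L := by exact_mod_cast hL1
  refine ⟨L, hL1', ?_, ?_⟩
  · have h1 : (L : ℝ) ≤ 2 * (χ / κ) := by
      have := (Nat.ceil_lt_add_one (by positivity : 0 ≤ χ / κ)).le
      have h2 := hχ1.trans hχκ
      rw [← hL] at this
      linarith
    have h2 : 2 * (χ / κ) = 16 * J * S * A ^ (1 / β) * Δ ^ (-(1 + 1 / β)) := by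
      rw [hχ, hκ, Real.div_rpow hA0.le hΔ.le, neg_add, Real.rpow_add hΔ, Real.rpow_neg_one,
        Real.rpow_neg hΔ.le]
      field_simp
      ring
    rw [h2] at h1
    refine h1.trans (mul_le_mul_of_nonneg_right ?_ (by positivity))
    have : 0 ≤ 8 * c := by positivity
    linarith
  · intro n _ _ pos H G z a hH hG ha haΔ
    have ha0 : 0 ≤ a := (norm_nonneg _).trans ha
    set Hs := shortRange pos χ H with hHs
    set Hl := H - Hs with hHl
    have hHln : ‖Hl‖ ≤ J * S' * (Δ / A) := by
      have := norm_longRange_le hJ.le hχ0 hβ0.le hS' hH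
      rw [hχβ] at this
      linarith
    have hHla : ‖-Hl‖ * a ≤ 1 / 2 := by
      rw [norm_neg]
      calc ‖Hl‖ * a ≤ J * S' * (Δ / A) * a := by gcongr
        _ = (2 * J * S') / A * (a * Δ) / 2 := by ring
        _ ≤ 1 * 1 / 2 := by
            gcongr
            exact (div_le_one hA0).2 hA2
        _ = 1 / 2 := by norm_num
    have hHsl : (H - z • 1) + -Hl = Hs - z • 1 := by rw [hHl]; abel
    have hG' : G * (H - z • 1) = 1 := mul_eq_one_comm.1 hG
    obtain ⟨Gs, hGs⟩ := exists_perturbed_inverse hG ha hHla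
    have hGsn := norm_le_of_perturbed_inverse hG' hGs ha hHla
    rw [hHsl] at hGs
    have hGs' : Gs * (Hs - z • 1) = 1 := mul_eq_one_comm.1 hGs
    have hGsd : BlockDecay (cell L ∘ pos) α (4 * a * c) Gs := by
      refine (BlockDecay.of_combesThomas hL1' hJ.le hS hχ0 hκ0.le hκ1 (hH.shortRange χ) ?_ hGs hGsn
        ?_ ?_ hc).mono (le_of_eq (by ring))
      · intro i j hij
        simp [shortRange, not_le.2 hij]
      · have : 2 * κ * J * S * (2 * a) = (a * Δ) / 2 := by
          rw [hκ]
          field_simp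
          ring
        rw [this]
        linarith
      · rw [mul_comm]
        exact (div_le_iff₀ hκ0).1 hLge
    set h : ℝ := 3 ^ α * J * (S' + 1) * (Δ / A) with hh
    have hHld : BlockDecay (cell L ∘ pos) α h Hl := by
      refine (BlockDecay.coarse hL1' hα0 hJ.le (hH.longRange χ) hHln).mono ?_
      have hLd : (L : ℝ) ^ ((d : ℝ) - α) ≤ Δ / A := by
        rw [← hχβ]
        calc (L : ℝ) ^ ((d : ℝ) - α) ≤ χ ^ ((d : ℝ) - α) :=
              Real.rpow_le_rpow_of_nonpos hχ0 (hχκ.trans hLge) (by linarith)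
          _ ≤ χ ^ (-β) := Real.rpow_le_rpow_of_exponent_le hχ1 (by linarith)
      calc _ ≤ 3 ^ α * (J * S' * (Δ / A) + J * (Δ / A)) := by gcongr
        _ = h := by rw [hh]; ring
    have hGeq : G = Gs - Gs * Hl * G := by
      have h1 : (Hs - z • 1) * G = 1 - Hl * G := by
        have h2 : Hs - z • 1 = (H - z • 1) - Hl := by rw [hHl]; abel
        rw [h2, sub_mul, hG]
      calc G = Gs * (Hs - z • 1) * G := by rw [hGs', Matrix.one_mul]
        _ = Gs - Gs * Hl * G := by
            rw [Matrix.mul_assoc, h1, Matrix.mul_sub, Matrix.mul_one, Matrix.mul_assoc]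
    have hsmall : K * (K * (4 * a * c) * h) ≤ 1 / 2 := by
      calc K * (K * (4 * a * c) * h)
          = (8 * K ^ 2 * c * 3 ^ α * J * (S' + 1)) / A * (a * Δ) / 2 := by rw [hh]; ring
        _ ≤ 1 * 1 / 2 := by
            gcongr
            exact (div_le_one hA0).2 hA1
        _ = 1 / 2 := by norm_num
    have hh0 : 0 ≤ h := by positivity
    have hfin : BlockDecay (cell L ∘ pos) α (2 * (4 * a * c)) G := by
      refine blockDecay_of_halving (by positivity) fun m hm0 hm => ?_
      rw [hGeq]
      refine (hGsd.sub ((hGsd.mul hα0 (by positivity) hh0 hS hHld).mul hα0 (by positivity) hm0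
        hS hm)).mono ?_
      rw [← hK]
      nlinarith [mul_le_mul_of_nonneg_right hsmall hm0]
    refine hfin.mono ?_
    have : 0 ≤ 16 * J * S * A ^ (1 / β) * a := by positivity
    linarith

end Resolvent

/-! ### The sign function as an integral of resolvents -/

section SignIntegral

open MeasureTheory

lemma div_sq_add_sq_eq {x : ℝ} (hx : x ≠ 0) (y : ℝ) :
    x / (x ^ 2 + y ^ 2) = x⁻¹ * (1 + (y / x) ^ 2)⁻¹ := by
  have : x ^ 2 + y ^ 2 ≠ 0 := by positivity
  field_simp

lemma integrable_div_sq_add_sq {x : ℝ} (hx : x ≠ 0) :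
    Integrable fun y : ℝ => x / (x ^ 2 + y ^ 2) := by
  simp_rw [div_sq_add_sq_eq hx]
  exact (integrable_inv_one_add_sq.comp_div hx).const_mul _

lemma integral_div_sq_add_sq {x : ℝ} (hx : x ≠ 0) :
    ∫ y : ℝ, x / (x ^ 2 + y ^ 2) = Real.pi * Real.sign x := by
  simp_rw [div_sq_add_sq_eq hx]
  rw [integral_const_mul, Measure.integral_comp_div (fun y : ℝ => (1 + y ^ 2)⁻¹),
    integral_univ_inv_one_add_sq, smul_eq_mul]
  rcases lt_or_gt_of_ne hx with h | h
  · rw [abs_of_neg h, Real.sign_of_neg h]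
    field_simp
  · rw [abs_of_pos h, Real.sign_of_pos h]
    field_simp

lemma norm_sum_integral_smul_le {ι E : Type*} [Fintype ι] [NormedAddCommGroup E] [NormedSpace ℝ E]
    [CompleteSpace E] {g : ι → ℝ → ℝ} (hg : ∀ i, Integrable (g i)) (v : ι → E) {b : ℝ → ℝ}
    (hb : Integrable b) (h : ∀ y, ‖∑ i, g i y • v i‖ ≤ b y) :
    ‖∑ i, (∫ y, g i y) • v i‖ ≤ ∫ y, b y := by
  have : ∑ i, (∫ y, g i y) • v i = ∫ y, ∑ i, g i y • v i := by
    rw [integral_finsetSum _ fun i _ => (hg i).smul_const (v i)]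
    simp_rw [integral_smul_const]
  rw [this]
  exact norm_integral_le_of_norm_le hb (Filter.Eventually.of_forall h)

end SignIntegral

section SpectralFunction

variable {n : Type*} [Fintype n] [DecidableEq n] {H : Matrix n n ℂ}

/-- The function `f` of the Hermitian matrix `H`, by diagonalization; `f` may be complex valued. -/
def specFun (hH : H.IsHermitian) (f : ℝ → ℂ) : Matrix n n ℂ :=
  (hH.eigenvectorUnitary : Matrix n n ℂ) * Matrix.diagonal (fun i => f (hH.eigenvalues i)) *
    star (hH.eigenvectorUnitary : Matrix n n ℂ)

variable (hH : H.IsHermitian)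

lemma specFun_mul (f g : ℝ → ℂ) :
    specFun hH f * specFun hH g = specFun hH fun x => f x * g x := by
  unfold specFun
  set U := (hH.eigenvectorUnitary : Matrix n n ℂ)
  have hU : star U * U = 1 := Unitary.coe_star_mul_self _
  calc _ = U * Matrix.diagonal (fun i => f (hH.eigenvalues i)) * (star U * U) *
        Matrix.diagonal (fun i => g (hH.eigenvalues i)) * star U := by simp only [Matrix.mul_assoc]
    _ = _ := by
      rw [hU, Matrix.mul_one, Matrix.mul_assoc U, Matrix.diagonal_mul_diagonal]

lemma specFun_const_one : specFun hH (fun _ => 1) = 1 := by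
  rw [specFun, Matrix.diagonal_one, Matrix.mul_one]
  exact Unitary.coe_mul_star_self _

lemma specFun_id : specFun hH (fun x => (x : ℂ)) = H := by
  conv_rhs => rw [hH.spectral_theorem]
  rfl

lemma specFun_congr {f g : ℝ → ℂ} (h : ∀ i, f (hH.eigenvalues i) = g (hH.eigenvalues i)) :
    specFun hH f = specFun hH g := by
  unfold specFun
  simp_rw [h]

lemma matrixSgn_eq_specFun : matrixSgn H = specFun hH fun x => (Real.sign x : ℂ) := by
  rw [matrixSgn, Matrix.IsHermitian.cfc_eq hH]
  rfl

lemma specFun_sub_smul (z : ℂ) : specFun hH (fun x => (x : ℂ) - z) = H - z • 1 := by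
  conv_rhs => rw [← specFun_id hH, ← specFun_const_one hH]
  unfold specFun
  rw [← Matrix.smul_mul, ← Matrix.mul_smul, ← Matrix.sub_mul, ← Matrix.mul_sub,
    ← Matrix.diagonal_smul, Matrix.diagonal_sub]
  simp

lemma norm_specFun (f : ℝ → ℂ) :
    ‖specFun hH f‖ = ‖fun i => f (hH.eigenvalues i)‖ := by
  rw [specFun, ← Unitary.coe_star, CStarRing.norm_mul_coe_unitary, CStarRing.norm_coe_unitary_mul,
    Matrix.l2_opNorm_diagonal]

lemma norm_specFun_le {f : ℝ → ℂ} {c : ℝ} (hc : 0 ≤ c) (h : ∀ i, ‖f (hH.eigenvalues i)‖ ≤ c) :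
    ‖specFun hH f‖ ≤ c := by
  rw [norm_specFun]
  exact (pi_norm_le_iff_of_nonneg hc).2 h

lemma abs_eigenvalues_le_norm (i : n) : |hH.eigenvalues i| ≤ ‖H‖ := by
  have := norm_le_pi_norm (fun i => ((hH.eigenvalues i : ℝ) : ℂ)) i
  rwa [← norm_specFun hH (fun x => (x : ℂ)), specFun_id, Complex.norm_real] at this

lemma norm_matrixSgn_le_one (hH : H.IsHermitian) : ‖matrixSgn H‖ ≤ 1 := by
  rw [matrixSgn_eq_specFun hH]
  refine norm_specFun_le hH zero_le_one fun i => ?_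
  rw [Complex.norm_real]
  rcases Real.sign_apply_eq (hH.eigenvalues i) with h | h | h <;> rw [h] <;> simp

lemma specFun_eq_sum (f : ℝ → ℝ) :
    specFun hH (fun x => (f x : ℂ)) =
      ∑ i, f (hH.eigenvalues i) • ((hH.eigenvectorUnitary : Matrix n n ℂ) *
        Matrix.diagonal (Pi.single i 1) * star (hH.eigenvectorUnitary : Matrix n n ℂ)) := by
  have h : Matrix.diagonal (fun i => (f (hH.eigenvalues i) : ℂ)) =
      ∑ i, f (hH.eigenvalues i) • Matrix.diagonal (Pi.single i (1 : ℂ)) := by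
    ext a b
    rw [Matrix.sum_apply]
    by_cases hab : a = b
    · subst hab
      simp [Pi.single_apply]
    · simp [hab]
  unfold specFun
  rw [h, Matrix.mul_sum, Matrix.sum_mul]
  refine Finset.sum_congr rfl fun i _ => ?_
  rw [Matrix.mul_smul, Matrix.smul_mul]

variable {hH}

/-- A bound on a block of `H (H ^ 2 + y ^ 2)⁻¹` that is integrable in `y` bounds the corresponding
block of `sgn H = π⁻¹ ∫ H (H ^ 2 + y ^ 2)⁻¹ dy`. -/
lemma norm_block_matrixSgn_le {ι : Type*} [DecidableEq ι] {pos : n → ι} {Δ c : ℝ} (hΔ : 0 < Δ)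
    (hgap : ∀ i, hH.eigenvalues i ≠ 0) {X Y : ι}
    (h : ∀ y : ℝ, ‖blockProj pos X * specFun hH (fun x => ((x / (x ^ 2 + y ^ 2) : ℝ) : ℂ)) *
      blockProj pos Y‖ ≤ c * (Δ / (Δ ^ 2 + y ^ 2))) :
    ‖blockProj pos X * matrixSgn H * blockProj pos Y‖ ≤ c := by
  set V : n → Matrix n n ℂ := fun i => blockProj pos X * ((hH.eigenvectorUnitary : Matrix n n ℂ) *
        Matrix.diagonal (Pi.single i 1) * star (hH.eigenvectorUnitary : Matrix n n ℂ)) *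
        blockProj pos Y with hV
  have hsum : ∀ f : ℝ → ℝ, blockProj pos X * specFun hH (fun x => (f x : ℂ)) * blockProj pos Y =
      ∑ i, f (hH.eigenvalues i) • V i := by
    intro f
    rw [specFun_eq_sum, Matrix.mul_sum, Matrix.sum_mul]
    refine Finset.sum_congr rfl fun i _ => ?_
    rw [Matrix.mul_smul, Matrix.smul_mul]
  have hint := norm_sum_integral_smul_le
    (g := fun i y => hH.eigenvalues i / (hH.eigenvalues i ^ 2 + y ^ 2))
    (fun i => integrable_div_sq_add_sq (hgap i)) V
    ((integrable_div_sq_add_sq hΔ.ne').const_mul c)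
    (fun y => by rw [← hsum fun x => x / (x ^ 2 + y ^ 2)]; exact h y)
  simp_rw [integral_div_sq_add_sq (hgap _)] at hint
  rw [MeasureTheory.integral_const_mul, integral_div_sq_add_sq hΔ.ne', Real.sign_of_pos hΔ,
    mul_one] at hint
  simp_rw [mul_smul] at hint
  rw [← Finset.smul_sum, ← hsum Real.sign, ← matrixSgn_eq_specFun hH, norm_smul, Real.norm_eq_abs,
    abs_of_pos Real.pi_pos, mul_comm] at hint
  exact le_of_mul_le_mul_right hint Real.pi_pos

end SpectralFunction

/-! ### Decay of the sign function -/

section SignDecay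

variable {n : Type} [Fintype n] [DecidableEq n] {d : ℕ} {pos : n → Fin d → ℤ} {α : ℝ}

/-- Decay over the cubes of side `L` is decay over the sites, at the expense of a factor `L ^ α`. -/
lemma BlockDecay.of_coarse {L : ℕ} (hL : 1 ≤ L) (hα : 0 ≤ α) {c : ℝ} (hc : 0 ≤ c)
    {M : Matrix n n ℂ} (hM : BlockDecay (cell L ∘ pos) α c M) :
    BlockDecay pos α (c * (L : ℝ) ^ α) M := by
  intro x y
  have hL0 : (0 : ℝ) < L := by exact_mod_cast hL
  have h1 : blockProj pos x * M * blockProj pos y = blockProj pos x *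
      (blockProj (cell L ∘ pos) (cell L x) * M * blockProj (cell L ∘ pos) (cell L y)) *
        blockProj pos y := by
    conv_lhs => rw [← blockProj_mul_blockProj_cell (pos := pos) L x,
      ← blockProj_cell_mul_blockProj (pos := pos) L y]
    simp only [Matrix.mul_assoc]
  rw [h1]
  refine (norm_block_le _ _ _).trans ((hM _ _).trans ?_)
  rw [mul_assoc]
  refine mul_le_mul_of_nonneg_left ?_ hc
  set D := dist (cell L x) (cell L y)
  have hD : 0 ≤ D := dist_nonneg
  calc (D + 1) ^ (-α) = (L : ℝ) ^ α * (L * (D + 1)) ^ (-α) := by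
        rw [Real.mul_rpow hL0.le (by positivity), ← mul_assoc, ← Real.rpow_add hL0]
        simp
    _ ≤ (L : ℝ) ^ α * (dist x y + 1) ^ (-α) := by
        refine mul_le_mul_of_nonneg_left ?_ (by positivity)
        exact Real.rpow_le_rpow_of_nonpos (by positivity) (dist_add_one_le hL x y) (by linarith)

/-- The sign of a gapped `α`-decaying Hermitian matrix is `α`-decaying, with an amplitude that grows
at most like the power `⌈α (α + 1) / (α - d)⌉` of the inverse gap. -/
theorem exists_matrixSgn_blockDecay (hd : 1 ≤ d) (hα : (d : ℝ) < α) {J : ℝ} (hJ : 0 < J) :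
    ∃ C : ℝ, 0 < C ∧ ∀ Δ : ℝ, 0 < Δ → ∀ (n : Type) [Fintype n] [DecidableEq n]
      (pos : n → Fin d → ℤ) (H : Matrix n n ℂ), H.IsHermitian → BlockDecay pos α J H →
      IsGapped Δ H →
      BlockDecay pos α (C * (1 / Δ) ^ ⌈α * (α + 1) / (α - d)⌉₊) (matrixSgn H) := by
  have hd1 : (1 : ℝ) ≤ d := by exact_mod_cast hd
  have hα0 : 0 < α := by linarith
  have hαd : 0 < α - d := by linarith
  obtain ⟨S, hS1, hS⟩ := exists_lattice_sum_le hd hα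
  set N : ℕ := ⌈α * (α + 1) / (α - d)⌉₊ with hN
  -- The long-range part is estimated with the exponent `β`. It lies below `α - d`, so that no
  -- asymptotics of tail sums is needed, and is just large enough for the final power of `1 / Δ`.
  set β : ℝ := α * (α - d) / (α + 1) with hβ
  have hβ0 : 0 < β := by positivity
  have hβd : β < α - d := by
    rw [hβ, div_lt_iff₀ (by positivity)]
    nlinarith
  obtain ⟨C, hC0, hC⟩ := exists_resolvent_blockDecay hd hα hJ hS1 hS hβ0 hβd
  set K : ℝ := 2 ^ α * 2 * S with hK
  have hK0 : 0 < K := by positivity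
  set h : ℝ := 3 ^ α * (J * S + J) with hh
  have hh0 : 0 < h := by positivity
  set e : ℝ := α * (1 + 1 / β) + 1 with he
  have heN : e ≤ N := by
    refine le_trans ?_ (Nat.le_ceil _)
    have : e = (α + 1) * (α - d + 1) / (α - d) := by
      rw [he, hβ]
      field_simp
      ring
    rw [this]
    refine div_le_div_of_nonneg_right ?_ hαd.le
    nlinarith
  refine ⟨K * (K * C * h) * C * C ^ α * (J * S) ^ ((N : ℝ) - e), by positivity,
    fun Δ hΔ n _ _ pos H hH hdec hgap => ?_⟩
  rcases isEmpty_or_nonempty n with hn | ⟨⟨i₀⟩⟩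
  · intro X Y
    rw [Subsingleton.elim (_ * _ * _) (0 : Matrix n n ℂ), norm_zero]
    positivity
  have hgap' : ∀ i, Δ ≤ |hH.eigenvalues i| := fun i => hgap _ (hH.eigenvalues_mem_spectrum_real i)
  have hHn : ‖H‖ ≤ J * S := norm_le_of_blockDecay hJ.le hS hdec
  have hΔJ : Δ ≤ J * S := (hgap' i₀).trans ((abs_eigenvalues_le_norm hH i₀).trans hHn)
  obtain ⟨L, hL1, hLle, hres⟩ := hC Δ hΔ hΔJ
  have hL1' : (1 : ℝ) ≤ L := by exact_mod_cast hL1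
  have hHc : BlockDecay (cell L ∘ pos) α h H := by
    refine (hdec.coarse hL1 hα0.le hJ.le hHn).mono ?_
    have : (L : ℝ) ^ ((d : ℝ) - α) ≤ 1 := Real.rpow_le_one_of_one_le_of_nonpos hL1' (by linarith)
    rw [hh]
    gcongr
    exact mul_le_of_le_one_right hJ.le this
  set a : ℝ → ℝ := fun y => 1 / √(Δ ^ 2 + y ^ 2) with ha
  have ha0 : ∀ y, 0 ≤ a y := fun y => by positivity
  have hpos : ∀ y : ℝ, 0 < Δ ^ 2 + y ^ 2 := fun y => by positivity
  have haΔ : ∀ y, a y * Δ ≤ 1 := by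
    intro y
    rw [ha, one_div_mul_eq_div, div_le_one (Real.sqrt_pos.2 (hpos y))]
    exact Real.le_sqrt_of_sq_le (by nlinarith [sq_nonneg y])
  have hne : ∀ (i : n) (y : ℝ), ((hH.eigenvalues i : ℝ) : ℂ) - Complex.I * y ≠ 0 := by
    intro i y h0
    have hre := congrArg Complex.re h0
    simp at hre
    have := hgap' i
    rw [hre, abs_zero] at this
    linarith
  have hG : ∀ y : ℝ, BlockDecay (cell L ∘ pos) α (C * a y)
      (specFun hH fun x => ((x : ℂ) - Complex.I * y)⁻¹) := by
    intro y
    refine hres n pos H _ (Complex.I * y) (a y) hdec ?_ ?_ (haΔ y)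
    · rw [← specFun_sub_smul hH, specFun_mul, ← specFun_const_one hH]
      exact specFun_congr hH fun i => mul_inv_cancel₀ (hne i y)
    · refine norm_specFun_le hH (ha0 y) fun i => ?_
      rw [norm_inv]
      change _ ≤ 1 / √(Δ ^ 2 + y ^ 2)
      rw [one_div]
      refine inv_anti₀ (Real.sqrt_pos.2 (hpos y)) ?_
      rw [Complex.norm_def]
      refine Real.sqrt_le_sqrt ?_
      have : Δ ^ 2 ≤ hH.eigenvalues i ^ 2 := by
        rw [← sq_abs (hH.eigenvalues i)]
        exact pow_le_pow_left₀ hΔ.le (hgap' i) 2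
      simp [Complex.normSq_apply]
      nlinarith
  have hprod : ∀ y : ℝ, specFun hH (fun x => ((x / (x ^ 2 + y ^ 2) : ℝ) : ℂ)) =
      (specFun hH fun x => ((x : ℂ) - Complex.I * y)⁻¹) * H *
        (specFun hH fun x => ((x : ℂ) - Complex.I * (-y : ℝ))⁻¹) := by
    intro y
    have hid : ∀ f g : ℝ → ℂ, specFun hH f * H * specFun hH g =
        specFun hH fun x => f x * x * g x := fun f g => by
      rw [← specFun_mul, ← specFun_mul, specFun_id]
    rw [hid]
    refine specFun_congr hH fun i => ?_
    have h1 := hne i y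
    have h2 := hne i (-y)
    have h3 : ((hH.eigenvalues i : ℂ) - Complex.I * y) *
        ((hH.eigenvalues i : ℂ) - Complex.I * (-y : ℝ)) =
          (hH.eigenvalues i : ℂ) ^ 2 + (y : ℂ) ^ 2 := by
      push_cast
      linear_combination (-(y : ℂ) ^ 2) * Complex.I_sq
    push_cast [← h3]
    push_cast at h2
    field_simp
  have hsgn : BlockDecay (cell L ∘ pos) α (K * (K * C * h) * C / Δ) (matrixSgn H) := by
    intro X Y
    refine norm_block_matrixSgn_le (hH := hH) hΔ (fun i h0 => ?_) fun y => ?_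
    · have := hgap' i
      rw [h0, abs_zero] at this
      linarith
    · have hb := (((hG y).mul hα0.le (mul_nonneg hC0.le (ha0 y)) hh0.le hS hHc).mul hα0.le
        (by positivity) (mul_nonneg hC0.le (ha0 (-y))) hS (hG (-y))) X Y
      rw [← hprod] at hb
      refine hb.trans (le_of_eq ?_)
      have haa : a y * a (-y) = 1 / (Δ ^ 2 + y ^ 2) := by
        rw [ha]
        dsimp only
        rw [neg_sq, div_mul_div_comm, one_mul, Real.mul_self_sqrt (hpos y).le]
      calc _ = K * (K * C * h) * C * (a y * a (-y)) * (dist X Y + 1) ^ (-α) := by rw [hK]; ring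
        _ = _ := by
          rw [haa]
          field_simp
  refine (hsgn.of_coarse hL1 hα0.le (by positivity)).mono ?_
  have hLα : (L : ℝ) ^ α ≤ C ^ α * Δ ^ (-(α * (1 + 1 / β))) := by
    calc (L : ℝ) ^ α ≤ (C * Δ ^ (-(1 + 1 / β))) ^ α :=
          Real.rpow_le_rpow (by positivity) hLle hα0.le
      _ = _ := by
          rw [Real.mul_rpow hC0.le (by positivity), ← Real.rpow_mul hΔ.le]
          ring_nf
  have hΔe : Δ ^ (-e) ≤ (J * S) ^ ((N : ℝ) - e) * (1 / Δ) ^ N := by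
    have : Δ ^ (-e) = Δ ^ ((N : ℝ) - e) * (1 / Δ) ^ N := by
      rw [one_div, inv_pow, ← Real.rpow_natCast, ← Real.rpow_neg hΔ.le, ← Real.rpow_add hΔ]
      ring_nf
    rw [this]
    gcongr
  calc _ ≤ K * (K * C * h) * C / Δ * (C ^ α * Δ ^ (-(α * (1 + 1 / β)))) := by gcongr
    _ = K * (K * C * h) * C * C ^ α * Δ ^ (-e) := by
        rw [he, neg_add, Real.rpow_add hΔ, Real.rpow_neg_one]
        ring
    _ ≤ K * (K * C * h) * C * C ^ α * ((J * S) ^ ((N : ℝ) - e) * (1 / Δ) ^ N) := by gcongr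
    _ = _ := by ring

end SignDecay

/-! ### Canonical anticommutation relations -/

section CAR

variable {ι : Type*} [Fintype ι]

/-- The Jordan–Wigner sign of the mode `i` in the configuration `T`. -/
def jwSign (i : ι) (T : Finset ι) : ℂ := (-1) ^ occupiedBefore i T

lemma jwSign_mul_self (i : ι) (T : Finset ι) : jwSign i T * jwSign i T = 1 := by
  rw [jwSign, ← mul_pow]
  norm_num

variable [DecidableEq ι]

lemma jwSign_insert {i j : ι} {T : Finset ι} (hj : j ∉ T) :
    jwSign i (insert j T) =
      if Fintype.equivFin ι j < Fintype.equivFin ι i then -jwSign i T else jwSign i T := by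
  unfold jwSign occupiedBefore
  rw [Finset.filter_insert]
  split_ifs with h
  · rw [Finset.card_insert_of_notMem (by simp [hj]), pow_succ]
    ring
  · rfl

lemma jwSign_insert_self {i : ι} {T : Finset ι} (hi : i ∉ T) :
    jwSign i (insert i T) = jwSign i T := by
  rw [jwSign_insert hi, if_neg (lt_irrefl _)]

/-- Of two distinct modes exactly one comes first, so that inserting each of them in turn changes
exactly one of the two signs. -/
lemma jwSign_mul_insert {i j : ι} {T : Finset ι} (hij : i ≠ j) (hi : i ∉ T) (hj : j ∉ T) :
    jwSign i T * jwSign j (insert i T) = -(jwSign j T * jwSign i (insert j T)) := by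
  rw [jwSign_insert hi, jwSign_insert hj]
  have hne : Fintype.equivFin ι i ≠ Fintype.equivFin ι j :=
    fun h => hij ((Fintype.equivFin ι).injective h)
  rcases lt_or_gt_of_ne hne with h | h
  · rw [if_pos h, if_neg h.not_gt]
    ring
  · rw [if_neg h.not_gt, if_pos h]
    ring

lemma annihilation_apply_insert (i : ι) {S T : Finset ι} (hi : i ∉ T) :
    annihilation i S (insert i T) = if S = T then jwSign i T else 0 := by
  rw [annihilation, Matrix.of_apply, Finset.erase_insert hi]
  simp only [Finset.mem_insert_self, true_and]
  split_ifs
  · exact jwSign_insert_self hi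
  · rfl

lemma annihilation_apply_of_notMem {i : ι} {S T : Finset ι} (hi : i ∉ T) :
    annihilation i S T = 0 := by
  rw [annihilation, Matrix.of_apply, if_neg fun h => hi h.1]

lemma creation_apply (i : ι) (S T : Finset ι) :
    creation i S T = if i ∉ T ∧ S = insert i T then jwSign i T else 0 := by
  rw [creation, Matrix.conjTranspose_apply]
  by_cases hS : i ∈ S
  · obtain ⟨U, hU, rfl⟩ : ∃ U, i ∉ U ∧ S = insert i U :=
      ⟨S.erase i, Finset.notMem_erase i S, (Finset.insert_erase hS).symm⟩
    rw [annihilation_apply_insert i hU]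
    by_cases hTU : T = U
    · subst hTU
      simp [hU, jwSign]
    · rw [if_neg hTU, if_neg, star_zero]
      rintro ⟨hT, h⟩
      refine hTU ?_
      rw [← Finset.erase_insert hT, ← h, Finset.erase_insert hU]
  · rw [annihilation_apply_of_notMem hS, star_zero, if_neg]
    rintro ⟨-, rfl⟩
    exact hS (Finset.mem_insert_self _ _)

lemma mul_annihilation_apply_insert (M : Matrix (Finset ι) (Finset ι) ℂ) (i : ι) {S T : Finset ι}
    (hi : i ∉ T) : (M * annihilation i) S (insert i T) = jwSign i T * M S T := by
  rw [Matrix.mul_apply]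
  simp_rw [annihilation_apply_insert i hi]
  simp [mul_comm]

lemma mul_annihilation_apply_of_notMem (M : Matrix (Finset ι) (Finset ι) ℂ) {i : ι}
    {S T : Finset ι} (hi : i ∉ T) : (M * annihilation i) S T = 0 := by
  rw [Matrix.mul_apply]
  simp [annihilation_apply_of_notMem hi]

lemma mul_creation_apply (M : Matrix (Finset ι) (Finset ι) ℂ) (i : ι) (S T : Finset ι) :
    (M * creation i) S T = if i ∉ T then jwSign i T * M S (insert i T) else 0 := by
  rw [Matrix.mul_apply]
  simp_rw [creation_apply]
  by_cases hi : i ∈ T <;> simp [hi, mul_comm]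

lemma creation_anticomm_creation (i j : ι) :
    creation i * creation j + creation j * creation i = 0 := by
  ext S T
  rw [Matrix.add_apply, mul_creation_apply, mul_creation_apply, Matrix.zero_apply]
  by_cases hij : i = j
  · subst hij
    simp [creation_apply]
  have hji : j ≠ i := fun h => hij h.symm
  by_cases hi : i ∈ T
  · simp [creation_apply, hi]
  by_cases hj : j ∈ T
  · simp [creation_apply, hj]
  have h := jwSign_mul_insert hij hi hj
  rw [creation_apply, creation_apply, Finset.insert_comm i j T]
  simp only [hi, hj, Finset.mem_insert, hij, hji, or_self, not_false_eq_true, true_and, if_true]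
  split_ifs
  · rw [h, add_neg_cancel]
  · simp

lemma annihilation_anticomm_creation (i j : ι) :
    annihilation i * creation j + creation j * annihilation i = if i = j then 1 else 0 := by
  ext S T
  rw [Matrix.add_apply, mul_creation_apply]
  by_cases hij : i = j
  · subst hij
    rw [if_pos rfl, Matrix.one_apply]
    by_cases hi : i ∈ T
    · obtain ⟨U, hU, rfl⟩ : ∃ U, i ∉ U ∧ T = insert i U :=
        ⟨T.erase i, Finset.notMem_erase i T, (Finset.insert_erase hi).symm⟩
      rw [mul_annihilation_apply_insert _ i hU, creation_apply]
      simp only [Finset.mem_insert_self, not_true_eq_false, if_false, zero_add, hU,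
        not_false_eq_true, true_and, mul_ite, jwSign_mul_self, mul_zero]
    · rw [mul_annihilation_apply_of_notMem _ hi, if_pos hi, annihilation_apply_insert i hi]
      simp only [mul_ite, jwSign_mul_self, mul_zero, add_zero]
  · have hji : j ≠ i := fun h => hij h.symm
    rw [if_neg hij, Matrix.zero_apply]
    by_cases hi : i ∈ T
    · obtain ⟨U, hU, rfl⟩ : ∃ U, i ∉ U ∧ T = insert i U :=
        ⟨T.erase i, Finset.notMem_erase i T, (Finset.insert_erase hi).symm⟩
      rw [mul_annihilation_apply_insert _ i hU, creation_apply, Finset.insert_comm]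
      by_cases hj : j ∈ U
      · simp [hj]
      have hiU : i ∉ insert j U := by simp [hij, hU]
      rw [annihilation_apply_insert i hiU]
      simp only [hj, Finset.mem_insert, hji, or_self, not_false_eq_true, true_and, if_true]
      split_ifs
      · rw [jwSign_insert hU, jwSign_insert hj]
        have hne : Fintype.equivFin ι i ≠ Fintype.equivFin ι j :=
          fun h => hij ((Fintype.equivFin ι).injective h)
        rcases lt_or_gt_of_ne hne with h | h
        · rw [if_pos h, if_neg h.not_gt]
          ring
        · rw [if_neg h.not_gt, if_pos h]
          ring
      · simp
    · rw [mul_annihilation_apply_of_notMem _ hi, annihilation_apply_of_notMem]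
      · simp
      · simp [hij, hi]

end CAR

/-! ### Ladder operators and ground states -/

section Ladder

variable {ι : Type*} [Fintype ι] {Hhat X : Matrix (Finset ι) (Finset ι) ℂ}
  {Ψ : Finset ι → ℂ}

lemma expectation_sub (O O' : Matrix (Finset ι) (Finset ι) ℂ) (Ψ : Finset ι → ℂ) :
    expectation (O - O') Ψ = expectation O Ψ - expectation O' Ψ := by
  simp [expectation, Matrix.sub_mulVec, dotProduct_sub]

lemma expectation_smul (c : ℂ) (O : Matrix (Finset ι) (Finset ι) ℂ) (Ψ : Finset ι → ℂ) :
    expectation (c • O) Ψ = c * expectation O Ψ := by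
  simp [expectation, Matrix.smul_mulVec, dotProduct_smul]

lemma expectation_sum {κ : Type*} (s : Finset κ) (O : κ → Matrix (Finset ι) (Finset ι) ℂ)
    (Ψ : Finset ι → ℂ) : expectation (∑ k ∈ s, O k) Ψ = ∑ k ∈ s, expectation (O k) Ψ := by
  simp [expectation, Matrix.sum_mulVec, dotProduct_sum]

lemma expectation_mul_eq_zero_right (O : Matrix (Finset ι) (Finset ι) ℂ) (h : X.mulVec Ψ = 0) :
    expectation (O * X) Ψ = 0 := by
  rw [expectation, ← Matrix.mulVec_mulVec, h, Matrix.mulVec_zero, dotProduct_zero]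

lemma expectation_mul_eq_zero_left (O : Matrix (Finset ι) (Finset ι) ℂ)
    (h : X.conjTranspose.mulVec Ψ = 0) : expectation (X * O) Ψ = 0 := by
  rw [expectation, ← Matrix.mulVec_mulVec, Matrix.dotProduct_mulVec,
    ← Matrix.conjTranspose_conjTranspose X, ← Matrix.star_mulVec, h, star_zero, zero_dotProduct]

variable [DecidableEq ι]

lemma expectation_one (hΨ : IsGroundState Hhat Ψ) : expectation 1 Ψ = 1 := by
  rw [expectation, Matrix.one_mulVec, hΨ.1]

/-- An operator that lowers the energy annihilates the ground state. -/
lemma IsGroundState.mulVec_eq_zero (hΨ : IsGroundState Hhat Ψ) {μ : ℝ} (hμ : μ < 0)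
    (h : Hhat * X - X * Hhat = (μ : ℂ) • X) : X.mulVec Ψ = 0 := by
  obtain ⟨-, E, hE, hmin⟩ := hΨ
  by_contra hne
  have heig : Hhat.mulVec (X.mulVec Ψ) = ((E + μ : ℝ) : ℂ) • X.mulVec Ψ := by
    rw [Matrix.mulVec_mulVec, eq_add_of_sub_eq h, Matrix.add_mulVec, Matrix.smul_mulVec,
      ← Matrix.mulVec_mulVec, hE, Matrix.mulVec_smul, ← add_smul]
    push_cast
    rw [add_comm]
  have hspec : E + μ ∈ spectrum ℝ Hhat := by
    rw [spectrum.mem_iff]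
    intro hu
    obtain ⟨B, hB⟩ := hu.exists_left_inv
    have hz : (algebraMap ℝ (Matrix (Finset ι) (Finset ι) ℂ) (E + μ) - Hhat).mulVec
        (X.mulVec Ψ) = 0 := by
      rw [Matrix.sub_mulVec, heig, Algebra.algebraMap_eq_smul_one, Matrix.smul_mulVec,
        Matrix.one_mulVec, sub_eq_zero]
      ext T
      simp [Complex.real_smul]
    apply hne
    rw [← Matrix.one_mulVec (X.mulVec Ψ), ← hB, ← Matrix.mulVec_mulVec, hz, Matrix.mulVec_zero]
  linarith [hmin _ hspec]

/-- The adjoint of an operator that raises the energy annihilates the ground state. -/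
lemma IsGroundState.conjTranspose_mulVec_eq_zero (hΨ : IsGroundState Hhat Ψ)
    (hH : Hhat.IsHermitian) {μ : ℝ} (hμ : 0 < μ)
    (h : Hhat * X - X * Hhat = (μ : ℂ) • X) : X.conjTranspose.mulVec Ψ = 0 := by
  refine hΨ.mulVec_eq_zero (μ := -μ) (by linarith) ?_
  have h' := congrArg Matrix.conjTranspose h
  rw [Matrix.conjTranspose_sub, Matrix.conjTranspose_mul, Matrix.conjTranspose_mul,
    Matrix.conjTranspose_smul, hH.eq] at h'
  rw [← neg_sub, h']
  simp

end Ladder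

/-! ### Recognizing the sign of a Hermitian matrix -/

section Recognize

variable {n : Type*} [Fintype n] [DecidableEq n] {H : Matrix n n ℂ}

/-- A matrix that multiplies the eigenvectors of a gapped matrix `H` by the sign of their eigenvalue
is the sign of `H`. -/
lemma eq_matrixSgn_of_eigenvectors (hH : H.IsHermitian) {Δ : ℝ} (hΔ : 0 < Δ) (hgap : IsGapped Δ H)
    {M : Matrix n n ℂ}
    (hpos : ∀ (v : n → ℂ) (x : ℝ), 0 < x → H.mulVec v = (x : ℂ) • v → M.mulVec v = v)
    (hneg : ∀ (v : n → ℂ) (x : ℝ), x < 0 → H.mulVec v = (x : ℂ) • v → M.mulVec v = -v) :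
    M = matrixSgn H := by
  rw [matrixSgn_eq_specFun hH, specFun]
  set U : Matrix n n ℂ := (hH.eigenvectorUnitary : Matrix n n ℂ) with hU
  have hUU : U * star U = 1 := Unitary.coe_mul_star_self _
  have hMU : M * U = U * Matrix.diagonal fun i => (Real.sign (hH.eigenvalues i) : ℂ) := by
    ext a i
    rw [Matrix.mul_diagonal]
    have hcol : ∀ b, U b i = (hH.eigenvectorBasis i) b := fun b => rfl
    have heig := hH.mulVec_eigenvectorBasis i
    set v : n → ℂ := (hH.eigenvectorBasis i).ofLp with hv
    have hMv : (M * U) a i = M.mulVec v a := rfl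
    have heig' : H.mulVec v = ((hH.eigenvalues i : ℝ) : ℂ) • v := heig
    rw [hMv, hcol]
    have hg := hgap _ (hH.eigenvalues_mem_spectrum_real i)
    have hne : hH.eigenvalues i ≠ 0 := fun h0 => by
      rw [h0, abs_zero] at hg
      linarith
    rcases lt_or_gt_of_ne hne with h | h
    · rw [hneg v _ h heig', Real.sign_of_neg h]
      simp [hv]
    · rw [hpos v _ h heig', Real.sign_of_pos h]
      simp [hv]
  calc M = M * (U * star U) := by rw [hUU, Matrix.mul_one]
    _ = _ := by rw [← Matrix.mul_assoc, hMU]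

end Recognize

/-! ### The covariance matrix of a ground state -/

section NumberConserving

variable {ι : Type*} [Fintype ι] [DecidableEq ι] {H : Matrix ι ι ℂ}

lemma conjTranspose_creation (i : ι) : (creation i).conjTranspose = annihilation i :=
  Matrix.conjTranspose_conjTranspose _

lemma isHermitian_numberHamiltonian (hH : H.IsHermitian) : (numberHamiltonian H).IsHermitian := by
  unfold numberHamiltonian
  rw [Matrix.IsHermitian, Matrix.conjTranspose_sum, Finset.sum_comm]
  refine Finset.sum_congr rfl fun q _ => ?_
  rw [Matrix.conjTranspose_sum]
  refine Finset.sum_congr rfl fun p _ => ?_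
  rw [Matrix.conjTranspose_smul, Matrix.conjTranspose_mul, conjTranspose_creation, hH.apply]
  rfl

lemma numberHamiltonian_commutator_creation (r : ι) :
    numberHamiltonian H * creation r - creation r * numberHamiltonian H =
      ∑ p, H p r • creation p := by
  unfold numberHamiltonian
  have hcomm : ∀ p q, creation p * annihilation q * creation r -
      creation r * (creation p * annihilation q) = if q = r then creation p else 0 := by
    intro p q
    have h1 := annihilation_anticomm_creation q r
    have h2 := creation_anticomm_creation p r
    calc _ = creation p * (annihilation q * creation r + creation r * annihilation q) -
          (creation p * creation r + creation r * creation p) * annihilation q := by noncomm_ring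
      _ = _ := by
        rw [h1, h2]
        split_ifs <;> simp
  simp_rw [Finset.sum_mul, Finset.mul_sum, ← Finset.sum_sub_distrib]
  refine Finset.sum_congr rfl fun p _ => ?_
  simp_rw [Matrix.smul_mul, Matrix.mul_smul, ← smul_sub, hcomm]
  simp

/-- The operator that creates a fermion in the one-particle state `v`. -/
def creationOf (v : ι → ℂ) : Matrix (Finset ι) (Finset ι) ℂ := ∑ q, v q • creation q

lemma numberHamiltonian_commutator_creationOf (v : ι → ℂ) :
    numberHamiltonian H * creationOf v - creationOf v * numberHamiltonian H =
      creationOf (H.mulVec v) := by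
  unfold creationOf
  rw [Finset.mul_sum, Finset.sum_mul, ← Finset.sum_sub_distrib]
  simp_rw [Matrix.smul_mul, Matrix.mul_smul, ← smul_sub, numberHamiltonian_commutator_creation,
    Finset.smul_sum, Matrix.mulVec, dotProduct, Finset.sum_smul, smul_smul]
  rw [Finset.sum_comm]
  simp_rw [mul_comm]

lemma creationOf_smul (c : ℂ) (v : ι → ℂ) : creationOf (c • v) = c • creationOf v := by
  simp [creationOf, Finset.smul_sum, smul_smul]

lemma covariance_mulVec (Ψ : Finset ι → ℂ) (v : ι → ℂ) (p : ι) :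
    (covariance Ψ).mulVec v p = expectation (creationOf v * annihilation p) Ψ := by
  simp [covariance, Matrix.mulVec, dotProduct, creationOf, Finset.sum_mul, expectation_sum,
    expectation_smul, mul_comm]

lemma annihilation_anticomm_creationOf (v : ι → ℂ) (p : ι) :
    annihilation p * creationOf v + creationOf v * annihilation p = v p • 1 := by
  unfold creationOf
  rw [Finset.mul_sum, Finset.sum_mul, ← Finset.sum_add_distrib]
  simp_rw [Matrix.smul_mul, Matrix.mul_smul, ← smul_add, annihilation_anticomm_creation]
  simp

/-- In a ground state all modes of negative energy are occupied and all modes of positive energy are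
empty. -/
theorem covariance_eq (hH : H.IsHermitian) {Δ : ℝ} (hΔ : 0 < Δ) (hgap : IsGapped Δ H)
    {Ψ : Finset ι → ℂ} (hΨ : IsGroundState (numberHamiltonian H) Ψ) :
    covariance Ψ = (1 / 2 : ℂ) • (1 - matrixSgn H) := by
  have hcomm : ∀ (v : ι → ℂ) (x : ℝ), H.mulVec v = (x : ℂ) • v →
      numberHamiltonian H * creationOf v - creationOf v * numberHamiltonian H =
        (x : ℂ) • creationOf v := fun v x hv => by
    rw [numberHamiltonian_commutator_creationOf, hv, creationOf_smul]
  have key : 1 - (2 : ℂ) • covariance Ψ = matrixSgn H := by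
    refine eq_matrixSgn_of_eigenvectors hH hΔ hgap (fun v x hx hv => ?_) fun v x hx hv => ?_
    · have h0 : (covariance Ψ).mulVec v = 0 := by
        ext p
        rw [covariance_mulVec, expectation_mul_eq_zero_left _
          (hΨ.conjTranspose_mulVec_eq_zero (isHermitian_numberHamiltonian hH) hx (hcomm v x hv))]
        rfl
      rw [Matrix.sub_mulVec, Matrix.smul_mulVec, h0, Matrix.one_mulVec, smul_zero, sub_zero]
    · have h0 : (covariance Ψ).mulVec v = v := by
        ext p
        rw [covariance_mulVec, eq_sub_of_add_eq' (annihilation_anticomm_creationOf v p),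
          expectation_sub, expectation_smul, expectation_one hΨ,
          expectation_mul_eq_zero_right _ (hΨ.mulVec_eq_zero hx (hcomm v x hv))]
        ring
      rw [Matrix.sub_mulVec, Matrix.smul_mulVec, h0, Matrix.one_mulVec]
      module
  rw [← key]
  module

end NumberConserving

/-! ### The Majorana covariance matrix of a ground state -/

section MajoranaCovariance

variable {S I : Type*} [Fintype S] [DecidableEq S] [Fintype I] [DecidableEq I]
  {A : Matrix (S × (I × Bool)) (S × (I × Bool)) ℝ}

lemma conjTranspose_majorana (x : S × (I × Bool)) :
    (majorana x).conjTranspose = majorana x := by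
  unfold majorana
  split_ifs
  · rw [Matrix.conjTranspose_add, conjTranspose_creation, add_comm]
    rfl
  · rw [Matrix.conjTranspose_smul, Matrix.conjTranspose_sub, conjTranspose_creation,
      Complex.star_def, Complex.conj_I, neg_smul, ← smul_neg, neg_sub]
    rfl

lemma annihilation_anticomm_annihilation {ι : Type*} [Fintype ι] [DecidableEq ι] (i j : ι) :
    annihilation i * annihilation j + annihilation j * annihilation i = 0 := by
  have h := congrArg Matrix.conjTranspose (creation_anticomm_creation i j)
  rwa [Matrix.conjTranspose_add, Matrix.conjTranspose_mul, Matrix.conjTranspose_mul,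
    conjTranspose_creation, conjTranspose_creation, Matrix.conjTranspose_zero, add_comm] at h

lemma majorana_anticomm (x y : S × (I × Bool)) :
    majorana x * majorana y + majorana y * majorana x = if x = y then (2 : ℂ) • 1 else 0 := by
  obtain ⟨r, s, b⟩ := x
  obtain ⟨r', s', b'⟩ := y
  set i : S × I := (r, s) with hi
  set j : S × I := (r', s') with hj
  have hcc := creation_anticomm_creation i j
  have haa := annihilation_anticomm_annihilation i j
  have hac := annihilation_anticomm_creation i j
  have hca := annihilation_anticomm_creation j i
  have hij : (i = j) ↔ (r = r' ∧ s = s') := by rw [hi, hj, Prod.mk.injEq]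
  have hji : (if j = i then (1 : Matrix (Finset (S × I)) (Finset (S × I)) ℂ) else 0) =
      if i = j then 1 else 0 := by simp only [eq_comm]
  rw [hji] at hca
  set δ : Matrix (Finset (S × I)) (Finset (S × I)) ℂ := if i = j then 1 else 0 with hδ
  have hsame : ((2 : ℂ) • δ) = if (r, s, b) = (r', s', b) then (2 : ℂ) • 1 else 0 := by
    rw [hδ]
    by_cases h : i = j
    · have h' := hij.1 h
      rw [if_pos h, if_pos (by rw [h'.1, h'.2])]
    · rw [if_neg h, if_neg, smul_zero]
      rintro h'
      simp only [Prod.mk.injEq, and_true] at h'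
      exact h (hij.2 h')
  cases b <;> cases b' <;>
    simp only [majorana, if_true, if_false, Bool.false_eq_true]
  · rw [← hsame]
    change (Complex.I • (creation i - annihilation i)) * (Complex.I • (creation j - annihilation j))
      + (Complex.I • (creation j - annihilation j)) *
        (Complex.I • (creation i - annihilation i)) = _
    calc _ = (Complex.I * Complex.I) • ((creation i * creation j + creation j * creation i)
          + (annihilation i * annihilation j + annihilation j * annihilation i)
          - (annihilation i * creation j + creation j * annihilation i)
          - (annihilation j * creation i + creation i * annihilation j)) := by
          rw [Matrix.smul_mul, Matrix.mul_smul, Matrix.smul_mul, Matrix.mul_smul, smul_smul,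
            smul_smul, ← smul_add]
          congr 1
          noncomm_ring
      _ = _ := by
          rw [hcc, haa, hac, hca, Complex.I_mul_I]
          module
  · rw [if_neg (by simp)]
    change (Complex.I • (creation i - annihilation i)) * (creation j + annihilation j)
      + (creation j + annihilation j) * (Complex.I • (creation i - annihilation i)) = _
    calc _ = Complex.I • ((creation i * creation j + creation j * creation i)
          - (annihilation i * annihilation j + annihilation j * annihilation i)
          - (annihilation i * creation j + creation j * annihilation i)
          + (annihilation j * creation i + creation i * annihilation j)) := by
          rw [Matrix.smul_mul, Matrix.mul_smul, ← smul_add]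
          congr 1
          noncomm_ring
      _ = _ := by
          rw [hcc, haa, hac, hca]
          simp
  · rw [if_neg (by simp)]
    change (creation i + annihilation i) * (Complex.I • (creation j - annihilation j))
      + (Complex.I • (creation j - annihilation j)) * (creation i + annihilation i) = _
    calc _ = Complex.I • ((creation i * creation j + creation j * creation i)
          - (annihilation i * annihilation j + annihilation j * annihilation i)
          + (annihilation i * creation j + creation j * annihilation i)
          - (annihilation j * creation i + creation i * annihilation j)) := by
          rw [Matrix.smul_mul, Matrix.mul_smul, ← smul_add]
          congr 1
          noncomm_ring
      _ = _ := by
          rw [hcc, haa, hac, hca]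
          simp
  · rw [← hsame]
    change (creation i + annihilation i) * (creation j + annihilation j)
      + (creation j + annihilation j) * (creation i + annihilation i) = _
    calc _ = (creation i * creation j + creation j * creation i)
          + (annihilation i * annihilation j + annihilation j * annihilation i)
          + (annihilation i * creation j + creation j * annihilation i)
          + (annihilation j * creation i + creation i * annihilation j) := by noncomm_ring
      _ = _ := by
          rw [hcc, haa, hac, hca]
          module

lemma isHermitian_iTimes {n : Type*} {A : Matrix n n ℝ} (hA : A.transpose = -A) :
    (iTimes A).IsHermitian := by
  ext i j
  have h : A j i = -A i j := congrFun (congrFun hA i) j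
  simp [iTimes, Matrix.conjTranspose_apply, h]

lemma isHermitian_majoranaHamiltonian (hA : A.transpose = -A) :
    (majoranaHamiltonian A).IsHermitian := by
  unfold majoranaHamiltonian
  rw [Matrix.IsHermitian, Matrix.conjTranspose_smul, Matrix.conjTranspose_sum]
  have h1 : ∀ x y, ((A x y : ℂ) • (majorana x * majorana y)).conjTranspose =
      -((A y x : ℂ) • (majorana y * majorana x)) := by
    intro x y
    have h : A y x = -A x y := congrFun (congrFun hA x) y
    rw [Matrix.conjTranspose_smul, Matrix.conjTranspose_mul, conjTranspose_majorana,
      conjTranspose_majorana, h]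
    simp
  simp_rw [Matrix.conjTranspose_sum, h1, Finset.sum_neg_distrib]
  rw [Finset.sum_comm, smul_neg, ← neg_smul]
  congr 1
  simp only [Complex.star_def, map_div₀, Complex.conj_I, map_ofNat]
  ring

/-- The Majorana operator `∑_x v_x γ̂_x` of a vector `v`. -/
def majoranaOf (v : S × (I × Bool) → ℂ) : Matrix (Finset (S × I)) (Finset (S × I)) ℂ :=
  ∑ x, v x • majorana x

lemma majoranaOf_smul (c : ℂ) (v : S × (I × Bool) → ℂ) :
    majoranaOf (c • v) = c • majoranaOf v := by
  simp [majoranaOf, Finset.smul_sum, smul_smul]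

lemma majorana_anticomm_majoranaOf (v : S × (I × Bool) → ℂ) (x : S × (I × Bool)) :
    majorana x * majoranaOf v + majoranaOf v * majorana x = (2 * v x) • 1 := by
  unfold majoranaOf
  rw [Finset.mul_sum, Finset.sum_mul, ← Finset.sum_add_distrib]
  simp_rw [Matrix.smul_mul, Matrix.mul_smul, ← smul_add, majorana_anticomm]
  simp [smul_smul, mul_comm]

lemma majoranaHamiltonian_commutator_majorana (hA : A.transpose = -A) (z : S × (I × Bool)) :
    majoranaHamiltonian A * majorana z - majorana z * majoranaHamiltonian A =
      (2 : ℂ) • ∑ x, iTimes A x z • majorana x := by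
  have hcomm : ∀ x y,
      majorana x * majorana y * majorana z - majorana z * (majorana x * majorana y) =
      (if y = z then (2 : ℂ) • majorana x else 0) - if x = z then (2 : ℂ) • majorana y else 0 := by
    intro x y
    calc _ = majorana x * (majorana y * majorana z + majorana z * majorana y) -
          (majorana x * majorana z + majorana z * majorana x) * majorana y := by noncomm_ring
      _ = _ := by
        rw [majorana_anticomm, majorana_anticomm]
        split_ifs <;> simp
  unfold majoranaHamiltonian
  rw [Matrix.smul_mul, Matrix.mul_smul, ← smul_sub]
  simp_rw [Finset.sum_mul, Finset.mul_sum, ← Finset.sum_sub_distrib, Matrix.smul_mul,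
    Matrix.mul_smul, ← smul_sub, hcomm, smul_sub, Finset.sum_sub_distrib]
  have h1 : ∑ x, ∑ y, (A x y : ℂ) • (if y = z then (2 : ℂ) • majorana x else 0) =
      (2 : ℂ) • ∑ x, (A x z : ℂ) • majorana x := by
    rw [Finset.smul_sum]
    refine Finset.sum_congr rfl fun x _ => ?_
    simp only [smul_ite, smul_zero, Finset.sum_ite_eq', Finset.mem_univ, if_true]
    exact smul_comm _ _ _
  have h2 : ∑ x, ∑ y, (A x y : ℂ) • (if x = z then (2 : ℂ) • majorana y else 0) =
      -((2 : ℂ) • ∑ x, (A x z : ℂ) • majorana x) := by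
    rw [Finset.sum_comm, Finset.smul_sum, ← Finset.sum_neg_distrib]
    refine Finset.sum_congr rfl fun y _ => ?_
    have h : A z y = -A y z := congrFun (congrFun hA y) z
    simp only [smul_ite, smul_zero, Finset.sum_ite_eq', Finset.mem_univ, if_true]
    rw [h, Complex.ofReal_neg, neg_smul, smul_comm]
  rw [h1, h2, sub_neg_eq_add, ← two_smul ℂ, smul_smul, smul_smul, Finset.smul_sum, Finset.smul_sum]
  refine Finset.sum_congr rfl fun x _ => ?_
  simp only [iTimes, Matrix.smul_apply, Matrix.map_apply, smul_eq_mul, smul_smul]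
  congr 1
  ring

lemma majoranaHamiltonian_commutator_majoranaOf (hA : A.transpose = -A)
    (v : S × (I × Bool) → ℂ) :
    majoranaHamiltonian A * majoranaOf v - majoranaOf v * majoranaHamiltonian A =
      (2 : ℂ) • majoranaOf ((iTimes A).mulVec v) := by
  unfold majoranaOf
  rw [Finset.mul_sum, Finset.sum_mul, ← Finset.sum_sub_distrib]
  simp_rw [Matrix.smul_mul, Matrix.mul_smul, ← smul_sub,
    majoranaHamiltonian_commutator_majorana hA, smul_comm _ (2 : ℂ), ← Finset.smul_sum]
  congr 1
  simp_rw [Finset.smul_sum, Matrix.mulVec, dotProduct, Finset.sum_smul, smul_smul]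
  rw [Finset.sum_comm]
  simp_rw [mul_comm]

lemma majoranaCovariance_mulVec (Ψ : Finset (S × I) → ℂ) (v : S × (I × Bool) → ℂ)
    (x : S × (I × Bool)) :
    (majoranaCovariance Ψ).mulVec v x = Complex.I / 2 *
      (expectation (majorana x * majoranaOf v) Ψ - expectation (majoranaOf v * majorana x) Ψ) := by
  simp only [majoranaCovariance, Matrix.mulVec, dotProduct, Matrix.of_apply, majoranaOf,
    Finset.mul_sum, Finset.sum_mul, expectation_sum, expectation_sub, Matrix.smul_mul,
    Matrix.mul_smul, expectation_smul, ← Finset.sum_sub_distrib]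
  refine Finset.sum_congr rfl fun y _ => ?_
  ring

/-- On an eigenvector `v` of `i A`, either `∑_x v_x γ̂_x` or its adjoint annihilates the ground
state, and the anticommutation relations give the remaining ordering of the operators. -/
theorem majoranaCovariance_eq (hA : A.transpose = -A) {Δ : ℝ} (hΔ : 0 < Δ)
    (hgap : IsGapped Δ (iTimes A)) {Ψ : Finset (S × I) → ℂ}
    (hΨ : IsGroundState (majoranaHamiltonian A) Ψ) :
    majoranaCovariance Ψ = Complex.I • matrixSgn (iTimes A) := by
  have hcomm : ∀ (v : S × (I × Bool) → ℂ) (x : ℝ), (iTimes A).mulVec v = (x : ℂ) • v →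
      majoranaHamiltonian A * majoranaOf v - majoranaOf v * majoranaHamiltonian A =
        ((2 * x : ℝ) : ℂ) • majoranaOf v := fun v x hv => by
    rw [majoranaHamiltonian_commutator_majoranaOf hA, hv, majoranaOf_smul, smul_smul]
    push_cast
    rfl
  have key : (-Complex.I) • majoranaCovariance Ψ = matrixSgn (iTimes A) := by
    refine eq_matrixSgn_of_eigenvectors (isHermitian_iTimes hA) hΔ hgap (fun v x hx hv => ?_)
      fun v x hx hv => ?_
    · ext y
      rw [Matrix.smul_mulVec, Pi.smul_apply, majoranaCovariance_mulVec,
        eq_sub_of_add_eq (majorana_anticomm_majoranaOf v y), expectation_sub, expectation_smul,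
        expectation_one hΨ, expectation_mul_eq_zero_left _
          (hΨ.conjTranspose_mulVec_eq_zero (isHermitian_majoranaHamiltonian hA)
            (by linarith : 0 < 2 * x) (hcomm v x hv)), smul_eq_mul]
      linear_combination (-v y) * Complex.I_mul_I
    · ext y
      rw [Matrix.smul_mulVec, Pi.smul_apply, majoranaCovariance_mulVec,
        eq_sub_of_add_eq' (majorana_anticomm_majoranaOf v y), expectation_sub, expectation_smul,
        expectation_one hΨ, expectation_mul_eq_zero_right _
          (hΨ.mulVec_eq_zero (by linarith : 2 * x < 0) (hcomm v x hv)), smul_eq_mul, Pi.neg_apply]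
      linear_combination (v y) * Complex.I_mul_I
  rw [← key, smul_smul]
  simp

end MajoranaCovariance

/-! ### Site blocks and the Euclidean distance -/

section SiteBlocks

variable {d : ℕ}

lemma dist_le_latticeDist (x y : Fin d → ℤ) : dist x y ≤ latticeDist x y := by
  refine (dist_pi_le_iff (Real.sqrt_nonneg _)).2 fun i => ?_
  rw [Int.dist_eq, ← Real.sqrt_sq_eq_abs]
  exact Real.sqrt_le_sqrt (Finset.single_le_sum (f := fun i => ((x i : ℝ) - y i) ^ 2)
    (fun _ _ => sq_nonneg _) (Finset.mem_univ i))

lemma latticeDist_add_one_le (hd : 1 ≤ d) (x y : Fin d → ℤ) :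
    latticeDist x y + 1 ≤ d * (dist x y + 1) := by
  have hd1 : (1 : ℝ) ≤ d := by exact_mod_cast hd
  have h0 : 0 ≤ dist x y := dist_nonneg
  have h : latticeDist x y ≤ d * dist x y := by
    refine Real.sqrt_le_iff.2 ⟨by positivity, ?_⟩
    calc ∑ i, ((x i : ℝ) - y i) ^ 2 ≤ ∑ _i : Fin d, dist x y ^ 2 := by
          refine Finset.sum_le_sum fun i _ => ?_
          rw [← sq_abs, ← Int.dist_eq]
          exact pow_le_pow_left₀ dist_nonneg (dist_le_pi_dist x y i) 2
      _ = d * dist x y ^ 2 := by simp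
      _ ≤ (d * dist x y) ^ 2 := by
          rw [mul_pow]
          exact mul_le_mul_of_nonneg_right (by nlinarith) (sq_nonneg _)
  linarith

lemma latticeDist_self (x : Fin d → ℤ) : latticeDist x x = 0 := by
  simp [latticeDist]

lemma one_le_latticeDist {x y : Fin d → ℤ} (h : x ≠ y) : 1 ≤ latticeDist x y := by
  refine le_trans ?_ (dist_le_latticeDist x y)
  obtain ⟨i, hi⟩ := Function.ne_iff.1 h
  refine le_trans ?_ (dist_le_pi_dist x y i)
  rw [Int.dist_eq]
  exact_mod_cast Int.one_le_abs (sub_ne_zero.2 hi)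

variable {Λ : Finset (Fin d → ℤ)} {K : Type*} [Fintype K] [DecidableEq K]

/-- The lattice position of a (site, internal state) pair. -/
def sitePos (p : Λ × K) : Fin d → ℤ := p.1.1

/-- The isometry that embeds the internal states at the site `r` into the whole system. -/
def siteEmbed (K : Type*) [DecidableEq K] (r : Λ) : Matrix (Λ × K) K ℂ :=
  Matrix.of fun p s => if p = (r, s) then 1 else 0

lemma siteBlock_eq (M : Matrix (Λ × K) (Λ × K) ℂ) (r r' : Λ) :
    siteBlock M r r' = (siteEmbed K r).conjTranspose * M * siteEmbed K r' := by
  ext s s'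
  simp [siteBlock, siteEmbed, Matrix.mul_apply, Matrix.conjTranspose_apply, apply_ite star]

lemma block_eq_siteBlock (M : Matrix (Λ × K) (Λ × K) ℂ) (r r' : Λ) :
    blockProj sitePos r.1 * M * blockProj sitePos r'.1 =
      siteEmbed K r * siteBlock M r r' * (siteEmbed K r').conjTranspose := by
  ext ⟨t, s⟩ ⟨t', s'⟩
  rw [block_apply]
  simp only [sitePos, siteBlock, siteEmbed, Matrix.mul_apply, Matrix.conjTranspose_apply,
    Matrix.of_apply, Prod.mk.injEq, ← Subtype.ext_iff]
  by_cases h : t = r <;> by_cases h' : t' = r' <;> simp [h, h', apply_ite star]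

lemma norm_siteEmbed_le (r : Λ) : ‖siteEmbed K r‖ ≤ 1 := by
  have h : (siteEmbed K r).conjTranspose * siteEmbed K r = 1 := by
    ext s s'
    simp [siteEmbed, Matrix.mul_apply, Matrix.conjTranspose_apply, Matrix.one_apply,
      apply_ite star, eq_comm]
  have h1 := Matrix.l2_opNorm_conjTranspose_mul_self (siteEmbed K r)
  rw [h, ← Matrix.diagonal_one, Matrix.l2_opNorm_diagonal] at h1
  have h2 : ‖(fun _ : K => (1 : ℂ))‖ ≤ 1 :=
    (pi_norm_le_iff_of_nonneg zero_le_one).2 fun i => by simp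
  nlinarith [norm_nonneg (siteEmbed K r)]

lemma opNorm_siteBlock_eq (M : Matrix (Λ × K) (Λ × K) ℂ) (r r' : Λ) :
    opNorm (siteBlock M r r') = ‖blockProj sitePos r.1 * M * blockProj sitePos r'.1‖ := by
  change ‖siteBlock M r r'‖ = _
  apply le_antisymm
  · have h : siteBlock M r r' = (siteEmbed K r).conjTranspose *
        (blockProj sitePos r.1 * M * blockProj sitePos r'.1) * siteEmbed K r' := by
      rw [← siteBlock_eq]
      ext s s'
      simp [siteBlock, block_apply, sitePos]
    rw [h]
    refine (Matrix.l2_opNorm_mul _ _).trans ?_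
    have h1 := Matrix.l2_opNorm_mul (siteEmbed K r).conjTranspose
      (blockProj sitePos r.1 * M * blockProj sitePos r'.1)
    rw [Matrix.l2_opNorm_conjTranspose] at h1
    calc _ ≤ 1 * ‖blockProj sitePos r.1 * M * blockProj sitePos r'.1‖ * 1 := by
          gcongr
          · refine h1.trans ?_
            gcongr
            exact norm_siteEmbed_le r
          · exact norm_siteEmbed_le r'
      _ = _ := by ring
  · rw [block_eq_siteBlock]
    refine (Matrix.l2_opNorm_mul _ _).trans ?_
    have h1 := Matrix.l2_opNorm_mul (siteEmbed K r) (siteBlock M r r')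
    rw [Matrix.l2_opNorm_conjTranspose]
    calc _ ≤ 1 * ‖siteBlock M r r'‖ * 1 := by
          gcongr
          · refine h1.trans ?_
            gcongr
            exact norm_siteEmbed_le r
          · exact norm_siteEmbed_le r'
      _ = _ := by ring

lemma opNorm_siteBlock_le (M : Matrix (Λ × K) (Λ × K) ℂ) (r r' : Λ) :
    opNorm (siteBlock M r r') ≤ ‖M‖ := by
  rw [opNorm_siteBlock_eq]
  exact norm_block_le M _ _

lemma IsDecaying.blockDecay {α J : ℝ} (hα : 0 ≤ α) (hJ : 0 ≤ J) {M : Matrix (Λ × K) (Λ × K) ℂ}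
    (hM : IsDecaying α J M) : BlockDecay sitePos α J M := by
  intro X Y
  have h0 : (0 : ℝ) ≤ J * (dist X Y + 1) ^ (-α) := by positivity
  by_cases hX : X ∈ Λ
  · by_cases hY : Y ∈ Λ
    · have h := hM ⟨X, hX⟩ ⟨Y, hY⟩
      rw [opNorm_siteBlock_eq, div_eq_mul_inv] at h
      refine h.trans (mul_le_mul_of_nonneg_left ?_ hJ)
      rw [Real.rpow_neg (by positivity)]
      refine inv_anti₀ (by positivity) (Real.rpow_le_rpow (by positivity) ?_ hα)
      have := dist_le_latticeDist X Y
      linarith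
    · rw [block_eq_zero (Or.inr fun p hp => hY (by rw [← hp]; exact p.1.2)), norm_zero]
      exact h0
  · rw [block_eq_zero (Or.inl fun p hp => hX (by rw [← hp]; exact p.1.2)), norm_zero]
    exact h0

lemma opNorm_iTimes_le (M : Matrix K K ℝ) : opNorm (iTimes M) ≤ opNorm M := by
  set T := Matrix.toEuclideanCLM (n := K) (𝕜 := ℝ) M with hT
  refine ContinuousLinearMap.opNorm_le_bound _ (norm_nonneg _) fun x => ?_
  refine le_of_sq_le_sq ?_ (mul_nonneg (norm_nonneg _) (norm_nonneg _))
  -- The real and the imaginary part of the vector are mapped separately.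
  set a : EuclideanSpace ℝ K := WithLp.toLp 2 fun s => (x s).re with ha
  set b : EuclideanSpace ℝ K := WithLp.toLp 2 fun s => (x s).im with hb
  have hx : ‖x‖ ^ 2 = ‖a‖ ^ 2 + ‖b‖ ^ 2 := by
    rw [EuclideanSpace.norm_sq_eq, EuclideanSpace.norm_sq_eq, EuclideanSpace.norm_sq_eq,
      ← Finset.sum_add_distrib]
    refine Finset.sum_congr rfl fun s _ => ?_
    rw [Complex.sq_norm, Complex.normSq_apply, Real.norm_eq_abs, Real.norm_eq_abs, sq_abs, sq_abs]
    simp only [ha, hb]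
    ring
  have hTx : ‖Matrix.toEuclideanCLM (n := K) (𝕜 := ℂ) (iTimes M) x‖ ^ 2 =
      ‖T a‖ ^ 2 + ‖T b‖ ^ 2 := by
    rw [EuclideanSpace.norm_sq_eq, EuclideanSpace.norm_sq_eq, EuclideanSpace.norm_sq_eq,
      ← Finset.sum_add_distrib]
    refine Finset.sum_congr rfl fun s _ => ?_
    rw [hT, Matrix.ofLp_toEuclideanCLM, Matrix.ofLp_toEuclideanCLM, Matrix.ofLp_toEuclideanCLM,
      iTimes, Matrix.smul_mulVec, Pi.smul_apply, norm_smul, Complex.norm_I, one_mul,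
      Complex.sq_norm, Complex.normSq_apply, Real.norm_eq_abs, Real.norm_eq_abs, sq_abs, sq_abs]
    simp [ha, hb, Matrix.mulVec, dotProduct]
    ring
  change ‖Matrix.toEuclideanCLM (n := K) (𝕜 := ℂ) (iTimes M) x‖ ^ 2 ≤ (‖T‖ * ‖x‖) ^ 2
  rw [hTx, mul_pow, hx, mul_add, ← mul_pow, ← mul_pow]
  gcongr <;> exact T.le_opNorm _

lemma IsDecaying.iTimes {α J : ℝ} {A : Matrix (Λ × K) (Λ × K) ℝ} (hA : IsDecaying α J A) :
    IsDecaying α J (FreeFermion.iTimes A) :=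
  fun r r' => (opNorm_iTimes_le (siteBlock A r r')).trans (hA r r')

end SiteBlocks

/-! ### From the decay of the sign function to the clustering bounds -/

section Clustering

/-- The blocks of a matrix `M` of norm at most `1`, whose off-diagonal blocks are dominated by those
of the sign of `H`, decay like the power `-α` of the distance. -/
theorem exists_siteBlock_bound (d : ℕ) (α J : ℝ) (hα : (d : ℝ) < α) (hJ : 0 < J) :
    ∃ c : ℝ, 0 < c ∧ ∀ Δ : ℝ, 0 < Δ →
      ∀ (Λ : Finset (Fin d → ℤ)) (K : Type) [Fintype K] [DecidableEq K]
        (H M : Matrix (Λ × K) (Λ × K) ℂ), H.IsHermitian → IsDecaying α J H → IsGapped Δ H →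
        ‖M‖ ≤ 1 →
        (∀ r r' : Λ, r ≠ r' → opNorm (siteBlock M r r') ≤ opNorm (siteBlock (matrixSgn H) r r')) →
        ∀ r r' : Λ,
          (latticeDist r.1 r'.1 = 0 ∧ opNorm (siteBlock M r r') ≤ 1) ∨
          (1 ≤ latticeDist r.1 r'.1 ∧ opNorm (siteBlock M r r') ≤
            c * (1 / Δ) ^ ⌈α * (α + 1) / (α - d)⌉₊ / (latticeDist r.1 r'.1 + 1) ^ α) := by
  have hdiag : ∀ (Λ : Finset (Fin d → ℤ)) (K : Type) [Fintype K] [DecidableEq K]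
      (M : Matrix (Λ × K) (Λ × K) ℂ), ‖M‖ ≤ 1 → ∀ r : Λ,
      latticeDist r.1 r.1 = 0 ∧ opNorm (siteBlock M r r) ≤ 1 :=
    fun Λ K _ _ M hM r => ⟨latticeDist_self _, (opNorm_siteBlock_le M r r).trans hM⟩
  rcases Nat.eq_zero_or_pos d with rfl | hd
  · refine ⟨1, one_pos, fun Δ hΔ Λ K _ _ H M _ _ _ hM _ r r' => Or.inl ?_⟩
    obtain rfl : r = r' := Subsingleton.elim _ _
    exact hdiag Λ K M hM r
  · obtain ⟨C, hC, h⟩ := exists_matrixSgn_blockDecay hd hα hJ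
    have hd1 : (1 : ℝ) ≤ d := by exact_mod_cast hd
    have hα0 : 0 < α := by linarith
    refine ⟨C * (d : ℝ) ^ α, by positivity,
      fun Δ hΔ Λ K _ _ H M hH hdec hgap hM hoff r r' => ?_⟩
    rcases eq_or_ne r r' with rfl | hne
    · exact Or.inl (hdiag Λ K M hM r)
    · refine Or.inr ⟨one_le_latticeDist (Subtype.coe_ne_coe.2 hne), (hoff r r' hne).trans ?_⟩
      rw [opNorm_siteBlock_eq]
      refine (h Δ hΔ (Λ × K) sitePos H hH (hdec.blockDecay hα0.le hJ.le) hgap r.1 r'.1).trans ?_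
      set ρ := latticeDist r.1 r'.1
      have hρ : 0 ≤ ρ := Real.sqrt_nonneg _
      have key : (dist r.1 r'.1 + 1) ^ (-α) ≤ (d : ℝ) ^ α / (ρ + 1) ^ α := by
        rw [Real.rpow_neg (by positivity), ← one_div, div_le_div_iff₀ (by positivity)
          (by positivity), one_mul, ← Real.mul_rpow (by positivity) (by positivity)]
        exact Real.rpow_le_rpow (by positivity) (latticeDist_add_one_le hd _ _) hα0.le
      calc _ ≤ C * (1 / Δ) ^ ⌈α * (α + 1) / (α - d)⌉₊ * ((d : ℝ) ^ α / (ρ + 1) ^ α) := by gcongr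
        _ = _ := by ring

/-- The polynomial of the clustering bound. As `log (ρ + 1) ≥ log 2` for distinct sites, its leading
term absorbs the power of the inverse gap. -/
def clusteringPolynomial (α c : ℝ) (N : ℕ) : ℝ[X] :=
  Polynomial.C 1 + Polynomial.C (c / (2 * α * Real.log 2) ^ N) * Polynomial.X ^ N

lemma natDegree_clusteringPolynomial_le (α c : ℝ) (N : ℕ) :
    (clusteringPolynomial α c N).natDegree ≤ N :=
  Polynomial.natDegree_add_le_of_degree_le (by simp)
    (Polynomial.natDegree_C_mul_X_pow_le _ _)

lemma le_clusteringBound {α Δ c b ρ : ℝ} {N : ℕ} (hα : 0 < α) (hΔ : 0 < Δ) (hc : 0 < c)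
    (h : (ρ = 0 ∧ b ≤ 1) ∨ (1 ≤ ρ ∧ b ≤ c * (1 / Δ) ^ N / (ρ + 1) ^ α)) :
    b ≤ clusteringBound α Δ (clusteringPolynomial α c N) 0 0 ρ := by
  have hlog2 : 0 < Real.log 2 := Real.log_pos one_lt_two
  simp only [clusteringBound, clusteringPolynomial, Polynomial.eval_add, Polynomial.eval_C,
    Polynomial.eval_mul, Polynomial.eval_pow, Polynomial.eval_X, zero_div, add_zero]
  rcases h with ⟨rfl, hb⟩ | ⟨hρ, hb⟩
  · refine hb.trans ?_
    rw [zero_add, Real.one_rpow, div_one, Real.log_one, mul_zero]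
    have : 0 ≤ c / (2 * α * Real.log 2) ^ N * 0 ^ N := by positivity
    linarith
  · refine hb.trans ?_
    have hρ0 : 0 < ρ + 1 := by linarith
    gcongr
    have hlog : Real.log 2 ≤ Real.log (ρ + 1) := Real.log_le_log two_pos (by linarith)
    calc c * (1 / Δ) ^ N = c / (2 * α * Real.log 2) ^ N * (2 * α / Δ * Real.log 2) ^ N := by
          rw [show 2 * α / Δ * Real.log 2 = 2 * α * Real.log 2 * (1 / Δ) by ring,
            mul_pow (2 * α * Real.log 2) (1 / Δ), ← mul_assoc, div_mul_cancel₀ _ (by positivity)]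
      _ ≤ c / (2 * α * Real.log 2) ^ N * (2 * α / Δ * Real.log (ρ + 1)) ^ N := by gcongr
      _ ≤ _ := by linarith

lemma le_max_div_rpow {α ε k b ρ : ℝ} (hε : 0 < ε)
    (h : (ρ = 0 ∧ b ≤ 1) ∨ (1 ≤ ρ ∧ b ≤ k / (ρ + 1) ^ α)) :
    b ≤ max 1 k / (ρ + 1) ^ (α - ε) := by
  rcases h with ⟨rfl, hb⟩ | ⟨hρ, hb⟩
  · rw [zero_add, Real.one_rpow, div_one]
    exact hb.trans (le_max_left _ _)
  · refine hb.trans ?_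
    have hρ0 : 0 < ρ + 1 := by linarith
    refine div_le_div₀ (by positivity) (le_max_right _ _) (by positivity) ?_
    exact Real.rpow_le_rpow_of_exponent_le (by linarith) (by linarith)

variable {d : ℕ} {Λ : Finset (Fin d → ℤ)} {K : Type*} [Fintype K] [DecidableEq K]
  {H : Matrix (Λ × K) (Λ × K) ℂ}

lemma norm_half_one_sub_matrixSgn_le (hH : H.IsHermitian) :
    ‖(1 / 2 : ℂ) • (1 - matrixSgn H)‖ ≤ 1 := by
  have h1 : ‖(1 : Matrix (Λ × K) (Λ × K) ℂ)‖ ≤ 1 := by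
    rw [← specFun_const_one hH]
    exact norm_specFun_le hH zero_le_one fun i => by simp
  have h2 := norm_matrixSgn_le_one hH
  rw [norm_smul]
  have h3 := norm_sub_le (1 : Matrix (Λ × K) (Λ × K) ℂ) (matrixSgn H)
  norm_num
  linarith

lemma opNorm_siteBlock_half_one_sub_le (M : Matrix (Λ × K) (Λ × K) ℂ) {r r' : Λ} (h : r ≠ r') :
    opNorm (siteBlock ((1 / 2 : ℂ) • (1 - M)) r r') ≤ opNorm (siteBlock M r r') := by
  have : siteBlock ((1 / 2 : ℂ) • (1 - M)) r r' = (-(1 / 2) : ℂ) • siteBlock M r r' := by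
    ext s s'
    simp [siteBlock, h]
  rw [this]
  change ‖(-(1 / 2) : ℂ) • siteBlock M r r'‖ ≤ ‖siteBlock M r r'‖
  rw [norm_smul]
  refine mul_le_of_le_one_left (norm_nonneg _) ?_
  norm_num

lemma opNorm_siteBlock_I_smul (M : Matrix (Λ × K) (Λ × K) ℂ) (r r' : Λ) :
    opNorm (siteBlock (Complex.I • M) r r') = opNorm (siteBlock M r r') := by
  change ‖Complex.I • siteBlock M r r'‖ = ‖siteBlock M r r'‖
  rw [norm_smul, Complex.norm_I, one_mul]

end Clustering

end FreeFermion

end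

theorem mainTheorem3 (d : ℕ) (α J : ℝ) (hα : (d : ℝ) < α) (hJ : 0 < J) :
    -- the case with particle-number conservation
    ((∃ (Q : ℝ[X]) (a b : ℝ),
        (Q.natDegree : ℝ) ≤ α * (α + 1) / (α - d) + 1 ∧
        ∀ Δ : ℝ, 0 < Δ →
        ∀ (Λ : Finset (Fin d → ℤ)) (I : Type) [Fintype I] [DecidableEq I]
          (H : Matrix (Λ × I) (Λ × I) ℂ),
          H.IsHermitian → FreeFermion.IsDecaying α J H → FreeFermion.IsGapped Δ H →
          ∀ Ψ : Finset (Λ × I) → ℂ,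
            FreeFermion.IsGroundState (FreeFermion.numberHamiltonian H) Ψ →
            FreeFermion.covariance Ψ = (1 / 2 : ℂ) • (1 - FreeFermion.matrixSgn H) ∧
            ∀ r r' : Λ,
              FreeFermion.opNorm (FreeFermion.siteBlock (FreeFermion.covariance Ψ) r r') ≤
                FreeFermion.clusteringBound α Δ Q a b (FreeFermion.latticeDist r.1 r'.1)) ∧
      (∀ Δ : ℝ, 0 < Δ → ∀ ε : ℝ, 0 < ε → ∃ K : ℝ,
        ∀ (Λ : Finset (Fin d → ℤ)) (I : Type) [Fintype I] [DecidableEq I]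
          (H : Matrix (Λ × I) (Λ × I) ℂ),
          H.IsHermitian → FreeFermion.IsDecaying α J H → FreeFermion.IsGapped Δ H →
          ∀ Ψ : Finset (Λ × I) → ℂ,
            FreeFermion.IsGroundState (FreeFermion.numberHamiltonian H) Ψ →
            ∀ r r' : Λ,
              FreeFermion.opNorm (FreeFermion.siteBlock (FreeFermion.covariance Ψ) r r') ≤
                K / (FreeFermion.latticeDist r.1 r'.1 + 1) ^ (α - ε))) ∧
    -- the case without particle-number conservation
    ((∃ (Q : ℝ[X]) (a b : ℝ),
        (Q.natDegree : ℝ) ≤ α * (α + 1) / (α - d) + 1 ∧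
        ∀ Δ : ℝ, 0 < Δ →
        ∀ (Λ : Finset (Fin d → ℤ)) (I : Type) [Fintype I] [DecidableEq I]
          (A : Matrix (Λ × (I × Bool)) (Λ × (I × Bool)) ℝ),
          A.transpose = -A → FreeFermion.IsDecaying α J A →
          FreeFermion.IsGapped Δ (FreeFermion.iTimes A) →
          ∀ Ψ : Finset (Λ × I) → ℂ,
            FreeFermion.IsGroundState (FreeFermion.majoranaHamiltonian A) Ψ →
            FreeFermion.majoranaCovariance Ψ =
              Complex.I • FreeFermion.matrixSgn (FreeFermion.iTimes A) ∧
            ∀ r r' : Λ,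
              FreeFermion.opNorm
                  (FreeFermion.siteBlock (FreeFermion.majoranaCovariance Ψ) r r') ≤
                FreeFermion.clusteringBound α Δ Q a b (FreeFermion.latticeDist r.1 r'.1)) ∧
      (∀ Δ : ℝ, 0 < Δ → ∀ ε : ℝ, 0 < ε → ∃ K : ℝ,
        ∀ (Λ : Finset (Fin d → ℤ)) (I : Type) [Fintype I] [DecidableEq I]
          (A : Matrix (Λ × (I × Bool)) (Λ × (I × Bool)) ℝ),
          A.transpose = -A → FreeFermion.IsDecaying α J A →
          FreeFermion.IsGapped Δ (FreeFermion.iTimes A) →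
          ∀ Ψ : Finset (Λ × I) → ℂ,
            FreeFermion.IsGroundState (FreeFermion.majoranaHamiltonian A) Ψ →
            ∀ r r' : Λ,
              FreeFermion.opNorm
                  (FreeFermion.siteBlock (FreeFermion.majoranaCovariance Ψ) r r') ≤
                K / (FreeFermion.latticeDist r.1 r'.1 + 1) ^ (α - ε))) := by
  have hα0 : 0 < α := lt_of_le_of_lt (Nat.cast_nonneg d) hα
  have hdeg : ∀ c : ℝ, ((FreeFermion.clusteringPolynomial α c
      ⌈α * (α + 1) / (α - d)⌉₊).natDegree : ℝ) ≤ α * (α + 1) / (α - d) + 1 := fun c => by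
    have h0 : 0 ≤ α * (α + 1) / (α - d) := div_nonneg (by positivity) (by linarith)
    exact (Nat.cast_le.2 (FreeFermion.natDegree_clusteringPolynomial_le _ _ _)).trans
      (Nat.ceil_lt_add_one h0).le
  obtain ⟨c, hc, hbound⟩ := FreeFermion.exists_siteBlock_bound d α J hα hJ
  refine ⟨⟨⟨FreeFermion.clusteringPolynomial α c _, 0, 0, hdeg c, ?_⟩, ?_⟩,
    ⟨FreeFermion.clusteringPolynomial α c _, 0, 0, hdeg c, ?_⟩, ?_⟩
  · intro Δ hΔ Λ I _ _ H hH hdec hgap Ψ hΨ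
    have hcov := FreeFermion.covariance_eq hH hΔ hgap hΨ
    refine ⟨hcov, fun r r' => FreeFermion.le_clusteringBound hα0 hΔ hc ?_⟩
    rw [hcov]
    exact hbound Δ hΔ Λ I H _ hH hdec hgap (FreeFermion.norm_half_one_sub_matrixSgn_le hH)
      (fun _ _ => FreeFermion.opNorm_siteBlock_half_one_sub_le _) r r'
  · refine fun Δ hΔ ε hε => ⟨_, fun Λ I _ _ H hH hdec hgap Ψ hΨ r r' =>
      FreeFermion.le_max_div_rpow (k := c * (1 / Δ) ^ ⌈α * (α + 1) / (α - d)⌉₊) hε ?_⟩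
    rw [FreeFermion.covariance_eq hH hΔ hgap hΨ]
    exact hbound Δ hΔ Λ I H _ hH hdec hgap (FreeFermion.norm_half_one_sub_matrixSgn_le hH)
      (fun _ _ => FreeFermion.opNorm_siteBlock_half_one_sub_le _) r r'
  · intro Δ hΔ Λ I _ _ A hA hdec hgap Ψ hΨ
    have hcov := FreeFermion.majoranaCovariance_eq hA hΔ hgap hΨ
    refine ⟨hcov, fun r r' => FreeFermion.le_clusteringBound hα0 hΔ hc ?_⟩
    rw [hcov, FreeFermion.opNorm_siteBlock_I_smul]
    have hH := FreeFermion.isHermitian_iTimes hA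
    exact hbound Δ hΔ Λ (I × Bool) _ _ hH hdec.iTimes hgap (FreeFermion.norm_matrixSgn_le_one hH)
      (fun _ _ _ => le_rfl) r r'
  · refine fun Δ hΔ ε hε => ⟨_, fun Λ I _ _ A hA hdec hgap Ψ hΨ r r' =>
      FreeFermion.le_max_div_rpow (k := c * (1 / Δ) ^ ⌈α * (α + 1) / (α - d)⌉₊) hε ?_⟩
    rw [FreeFermion.majoranaCovariance_eq hA hΔ hgap hΨ, FreeFermion.opNorm_siteBlock_I_smul]
    have hH := FreeFermion.isHermitian_iTimes hA
    exact hbound Δ hΔ Λ (I × Bool) _ _ hH hdec.iTimes hgap (FreeFermion.norm_matrixSgn_le_one hH)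
      (fun _ _ _ => le_rfl) r r'
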